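/- **Conventions.** All sets are finite. A bigraph $\mathcal G=(U,V;E)$ consists of vertex sets $U,V$ and $E\subseteq U\times V$; its density is $|E|/(|U||V|)$. It is *irreducible* if no two distinct vertices of $U$ have the same neighbours in $V$ and no two distinct vertices of $V$ have the same neighbours in $U$. For $v\in V$ let $N^1_{\mathcal G}(v)=\{u\in U:(u,v)\in E\}$ and $N^0_{\mathcal G}(v)=U\setminus N^1_{\mathcal G}(v)$. A bigraph $(X,Y;F)$ of density $d_0$ *has $\mathrm{dev}_2(\epsilon,d)$* if $|d_0-d|\le\epsilon$ and $$\sum_{x_0,x_1\in X}\sum_{y_0,y_1\in Y}\prod_{i,j\in\{0,1\}}g(x_i,y_j)\le\epsilon|X|^2|Y|^2,$$ where $g(x,y)=1-d_0$ if $(x,y)\in F$ and $g(x,y)=-d_0$ otherwise; it *has $\mathrm{dev}_2(\epsilon)$* if it has $\mathrm{dev}_2(\epsilon,d_0)$. A triad $G=(X,Y,Z;E_{XY},E_{XZ},E_{YZ})$ consists of three bigraphs on $X,Y,Z$, and $K_3(G)$ is its set of triangles $(x,y,z)\in X\times Y\times Z$. Let $H$ be a $3$-uniform hypergraph, let $\overline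 E(H)$ be the set of ordered triples $(x,y,z)$ with $\{x,y,z\}\in E(H)$, and let $d_H(G)=|\overline E(H)\cap K_3(G)|/|K_3(G)|$. Then $G$ *has $\mathrm{dev}_{2,3}(\epsilon_1,\epsilon_2)$ with respect to $H$* if there are $d_{XY},d_{XZ},d_{YZ}>0$ such that its component bigraphs have $\mathrm{dev}_2(\epsilon_2,d_{XY})$, $\mathrm{dev}_2(\epsilon_2,d_{XZ})$, $\mathrm{dev}_2(\epsilon_2,d_{YZ})$ respectively and $$\sum_{x_0,x_1\in X}\sum_{y_0,y_1\in Y}\sum_{z_0,z_1\in Z}\prod_{i,j,k\in\{0,1\}}h(x_i,y_j,z_k)\le\epsilon_1d_{XY}^4d_{XZ}^4d_{YZ}^4|X|^2|Y|^2|Z|^2,$$ where $h=1-d_H(G)$ on $K_3(G)\cap\overline E(H)$, $h=-d_H(G)$ on $K_3(G)\setminus\overline E(H)$, and $h=0$ off $K_3(G)$. A *$(t,\ell)$-decomposition* $\mathcal P$ of a set $W$ ($t,\ell\ge1$) consists of a partition $W=V_1\cup\dots\cup V_t$ and, for all $i,j\in[t]$, a partition $V_i\times V_j=P^1_{ij}\cup\dots\cup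 P^\ell_{ij}$ (empty members are allowed). Its triads are $(V_i,V_j,V_k;P^\alpha_{ij},P^\beta_{ik},P^\gamma_{jk})$. It is a *$(t,\ell,\epsilon_1,\epsilon_2)$-decomposition* if at least $(1-\epsilon_1)|W|^2$ pairs in $W^2$ lie in some $P^\alpha_{ij}$ such that $(V_i,V_j;P_{ij}^\alpha)$ has $\mathrm{dev}_2(\epsilon_2)$. When $W=V(H)$, it is *$\mathrm{dev}_{2,3}(\epsilon_1,\epsilon_2)$-regular* for $H$ if all but at most $\epsilon_1|W|^3$ triples in $W^3$ lie in $K_3(G)$ for some triad $G$ of $\mathcal P$ having $\mathrm{dev}_{2,3}(\epsilon_1,\epsilon_2)$ with respect to $H$. A *bipartite $U$-colored graph* $\Gamma=(A\cup B,(P_u)_{u\in U})$ consists of disjoint sets $A,B$ and a partition of the set of pairs $\{x,y\}$ ($x\in A$, $y\in B$) into classes $P_u$, $u\in U$. For a set $F$ of such pairs, $A'\subseteq A$ and $B'\subseteq B$, put $d_F(A',B')=|\{(x,y)\in A'\times B':\{x,y\}\in F\}|/(|A'||B'|)$; $(A\cup B,F)$ is *$\epsilon$-regular* if $|d_F(A,B)-d_F(A',B')|\le\epsilon$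 whenever $|A'|\ge\epsilon|A|$ and $|B'|\ge\epsilon|B|$. An *$(m,\Gamma)$-blowup* of $\mathcal G=(U,V;E)$ is a $3$-uniform hypergraph $H$ with vertex set $A\cup B\cup C$, where $C=\bigcup_{v\in V}C_v$ is a disjoint union of new sets $C_v$ of size $m$, such that for all $u\in U$, $v\in V$, $\{x,y\}\in P_u$ and $z\in C_v$: $\{x,y,z\}\in E(H)$ if and only if $(u,v)\in E$. Other triples may be edges or not. **Lemma.** There are real numbers $D,\epsilon^*>0$ such that the following holds. Let $\mathcal G=(U,V;E)$ be an irreducible bigraph with $U,V$ nonempty. For all $0<\epsilon_1<\min\{|V|^{-D},(\epsilon^*)^D\}$ there is $\epsilon_2^*:\mathbb N\to(0,1)$ such that for all $t\ge1$ and all $\epsilon_2:\mathbb N\to(0,1)$ with $\epsilon_2(x)<\epsilon_2^*(x)$ for all $x$, there is $\epsilon>0$ such that for all sufficiently large $n$ divisible by $|V|$ the following holds. Let $\Gamma=(A\cup B,(P_u)_{u\in U})$ be a bipartite $U$-colored graph with $|A|=|B|=n$ such that for each $u\in U$, $(A\cup B,P_u)$ is $\epsilon$-regular and $|d_{P_u}(A,B)-1/|U||\le\epsilon$.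 Let $H$ be an $(n/|V|,\Gamma)$-blowup of $\mathcal G$, with classes $C_v$ ($v\in V$) and $C=\bigcup_{v\in V}C_v$. Let $\ell\ge 1$ and let $\mathcal P$ be a $\mathrm{dev}_{2,3}(\epsilon_1^D,\epsilon_2(\ell)^D)$-regular $(3t,\ell,\epsilon_1^D,\epsilon_2(\ell)^D)$-decomposition for $H$ each of whose vertex parts is contained in $A$, $B$ or $C$. Then there are vertex parts $A_i\subseteq A$ and $B_j\subseteq B$ of $\mathcal P$, where $A_i\times B_j$ is partitioned by $\mathcal P$ into $P^1_{A_iB_j},\dots,P^\ell_{A_iB_j}$, a set $\mathcal Z\subseteq[\ell]$, for each $\alpha\in\mathcal Z$ a set $\mathcal C_\alpha\subseteq V$, and for all $\alpha\in\mathcal Z$ and $v\in\mathcal C_\alpha$ a value $f(\alpha,v)\in\{0,1\}$, such that 1. $|A_i|\ge\epsilon_1^D|A|/(3t)$ and $|B_j|\ge\epsilon_1^D|B|/(3t)$; 2. $\big|\bigcup_{\alpha\in\mathcal Z}P^\alpha_{A_iB_j}\big|\ge(1-\epsilon_1^{D/4})|A_i||B_j|$; 3. $|\mathcal C_\alpha|\ge(1-3\epsilon_1^{D/8})|V|$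 for all $\alpha\in\mathcal Z$; 4. for all $\alpha\in\mathcal Z$, the number of $(x,y)\in P^\alpha_{A_iB_j}$ such that for every $v\in\mathcal C_\alpha$ there is $u\in N_{\mathcal G}^{f(\alpha,v)}(v)$ with $\{x,y\}\in P_u$ is at least $(1-\epsilon_1^{1/32})|P^\alpha_{A_iB_j}|$; that is, $$\Big|P^\alpha_{A_iB_j}\cap\bigcap_{v\in\mathcal C_\alpha}\ \bigcup_{u\in N_{\mathcal G}^{f(\alpha,v)}(v)}P_u\Big|\ge(1-\epsilon_1^{1/32})|P^\alpha_{A_iB_j}|.$$ -/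

import Mathlib

noncomputable section

namespace TripleReg

/-- A bigraph `(X, Y; E)`: finite vertex sets (inside ambient types) and `E ⊆ X × Y`. -/
structure Bigraph (α β : Type*) where
  left : Finset α
  right : Finset β
  E : Finset (α × β)
  E_sub : E ⊆ left ×ˢ right

namespace Bigraph

variable {α β : Type*} [DecidableEq α] [DecidableEq β]

/-- The density `|E| / (|X||Y|)`. -/
def density (G : Bigraph α β) : ℝ :=
  (G.E.card : ℝ) / ((G.left.card : ℝ) * (G.right.card : ℝ))

/-- The centred indicator: `1 - d` on edges, `-d` on non-edges. -/
def balanced (G : Bigraph α β) (x : α) (y : β) : ℝ :=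
  if (x, y) ∈ G.E then 1 - G.density else -G.density

/-- `G` has `dev₂(ε, d)`. -/
def HasDev2With (G : Bigraph α β) (ε d : ℝ) : Prop :=
  |G.density - d| ≤ ε ∧
  ∑ u₀ ∈ G.left, ∑ u₁ ∈ G.left, ∑ w₀ ∈ G.right, ∑ w₁ ∈ G.right,
      ∏ i : Fin 2, ∏ j : Fin 2, G.balanced (![u₀, u₁] i) (![w₀, w₁] j)
    ≤ ε * (G.left.card : ℝ) ^ 2 * (G.right.card : ℝ) ^ 2

/-- `G` has `dev₂(ε)`. -/
def HasDev2 (G : Bigraph α β) (ε : ℝ) : Prop :=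
  G.HasDev2With ε G.density

/-- `G` is irreducible: distinct vertices on the same side have distinct neighbourhoods, i.e. all
classes of the two twin relations are singletons. -/
def Irreducible (G : Bigraph α β) : Prop :=
  (∀ x ∈ G.left, ∀ y ∈ G.left,
    (∀ z ∈ G.right, (x, z) ∈ G.E ↔ (y, z) ∈ G.E) → x = y) ∧
  (∀ x ∈ G.right, ∀ y ∈ G.right,
    (∀ z ∈ G.left, (z, x) ∈ G.E ↔ (z, y) ∈ G.E) → x = y)

/-- For `v` on the right: `N¹(v)` (for `b = true`) is the neighbourhood of `v` in the left vertex
set, and `N⁰(v)` (for `b = false`) is its complement in the left vertex set. -/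
def nbr (G : Bigraph α β) (b : Bool) (v : β) : Finset α :=
  match b with
  | true => G.left.filter fun u => (u, v) ∈ G.E
  | false => G.left.filter fun u => (u, v) ∉ G.E

end Bigraph

/-- A trigraph `(X, Y, Z; E)` with `E ⊆ X × Y × Z`. -/
structure Trigraph (α : Type*) where
  X : Finset α
  Y : Finset α
  Z : Finset α
  E : Finset (α × α × α)
  E_sub : E ⊆ X ×ˢ Y ×ˢ Z

/-- A triad `(X, Y, Z; E_XY, E_XZ, E_YZ)`. -/
structure Triad (α : Type*) where
  X : Finset α
  Y : Finset α
  Z : Finset α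
  EXY : Finset (α × α)
  EXZ : Finset (α × α)
  EYZ : Finset (α × α)
  EXY_sub : EXY ⊆ X ×ˢ Y
  EXZ_sub : EXZ ⊆ X ×ˢ Z
  EYZ_sub : EYZ ⊆ Y ×ˢ Z

namespace Triad

variable {α : Type*} [DecidableEq α]

/-- The component bigraph on `X, Y`. -/
def compXY (G : Triad α) : Bigraph α α := ⟨G.X, G.Y, G.EXY, G.EXY_sub⟩

/-- The component bigraph on `X, Z`. -/
def compXZ (G : Triad α) : Bigraph α α := ⟨G.X, G.Z, G.EXZ, G.EXZ_sub⟩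

/-- The component bigraph on `Y, Z`. -/
def compYZ (G : Triad α) : Bigraph α α := ⟨G.Y, G.Z, G.EYZ, G.EYZ_sub⟩

/-- The set of ordered triangles of a triad. -/
def K3 (G : Triad α) : Finset (α × α × α) :=
  (G.X ×ˢ G.Y ×ˢ G.Z).filter fun p =>
    (p.1, p.2.1) ∈ G.EXY ∧ (p.2.1, p.2.2) ∈ G.EYZ ∧ (p.1, p.2.2) ∈ G.EXZ

end Triad

namespace Trigraph

variable {α : Type*} [DecidableEq α]

/-- The trigraph `H|G`: the edges of `H` that are triangles of `G`. -/
def restrict (H : Trigraph α) (G : Triad α) : Trigraph α where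
  X := G.X
  Y := G.Y
  Z := G.Z
  E := H.E ∩ G.K3
  E_sub := Finset.inter_subset_right.trans (Finset.filter_subset _ _)

/-- The relative density `d_H(G) = |E ∩ K₃(G)| / |K₃(G)|`. -/
def relDensity (H : Trigraph α) (G : Triad α) : ℝ :=
  ((H.E ∩ G.K3).card : ℝ) / (G.K3.card : ℝ)

/-- The triad `G` underlies the trigraph `H`. -/
def UnderlaidBy (H : Trigraph α) (G : Triad α) : Prop :=
  G.X = H.X ∧ G.Y = H.Y ∧ G.Z = H.Z ∧ H.E ⊆ G.K3

/-- The centred indicator of `H` relative to `G`, supported on the triangles of `G`. -/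
def balanced (H : Trigraph α) (G : Triad α) (x y z : α) : ℝ :=
  if (x, y, z) ∈ G.K3 then
    (if (x, y, z) ∈ H.E then 1 - H.relDensity G else -H.relDensity G)
  else 0

/-- `(H, G)` has `dev_{2,3}(ε₁, ε₂)`. -/
def HasDev23 (H : Trigraph α) (G : Triad α) (ε₁ ε₂ : ℝ) : Prop :=
  H.UnderlaidBy G ∧
  ∃ dXY dYZ dXZ : ℝ, 0 < dXY ∧ 0 < dYZ ∧ 0 < dXZ ∧
    G.compXY.HasDev2With ε₂ dXY ∧ G.compXZ.HasDev2With ε₂ dXZ ∧ G.compYZ.HasDev2With ε₂ dYZ ∧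
    ∑ u₀ ∈ G.X, ∑ u₁ ∈ G.X, ∑ w₀ ∈ G.Y, ∑ w₁ ∈ G.Y, ∑ z₀ ∈ G.Z, ∑ z₁ ∈ G.Z,
        ∏ i : Fin 2, ∏ j : Fin 2, ∏ k : Fin 2,
          H.balanced G (![u₀, u₁] i) (![w₀, w₁] j) (![z₀, z₁] k)
      ≤ ε₁ * dXY ^ 4 * dYZ ^ 4 * dXZ ^ 4 *
          (G.X.card : ℝ) ^ 2 * (G.Y.card : ℝ) ^ 2 * (G.Z.card : ℝ) ^ 2

end Trigraph

/-- A finite 3-uniform hypergraph. -/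
structure ThreeGraph (α : Type*) where
  verts : Finset α
  edges : Finset (Finset α)
  edges_sub : edges ⊆ verts.powersetCard 3

/-- The trigraph of ordered triples coming from the edges of a 3-graph. -/
def ThreeGraph.bar {α : Type*} [DecidableEq α] (H : ThreeGraph α) : Trigraph α where
  X := H.verts
  Y := H.verts
  Z := H.verts
  E := (H.verts ×ˢ H.verts ×ˢ H.verts).filter fun p => ({p.1, p.2.1, p.2.2} : Finset α) ∈ H.edges
  E_sub := Finset.filter_subset _ _

/-- A `(t, ℓ)`-decomposition of `V`: an indexed partition of `V` into `t` parts and, for every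
ordered pair of parts, an indexed partition of their product into `ℓ` classes.  Members of the
indexed partitions may be empty. -/
structure Decomposition {α : Type*} [DecidableEq α] (V : Finset α) (t l : ℕ) where
  t_pos : 0 < t
  l_pos : 0 < l
  part : Fin t → Finset α
  part_disjoint : ∀ i j, i ≠ j → Disjoint (part i) (part j)
  part_cover : Finset.univ.biUnion part = V
  P : Fin t → Fin t → Fin l → Finset (α × α)
  P_disjoint : ∀ i j a b, a ≠ b → Disjoint (P i j a) (P i j b)
  P_cover : ∀ i j, Finset.univ.biUnion (P i j) = part i ×ˢ part j

namespace Decomposition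

variable {α : Type*} [DecidableEq α] {V : Finset α} {t l : ℕ}

theorem P_sub (Q : Decomposition V t l) (i j : Fin t) (a : Fin l) :
    Q.P i j a ⊆ Q.part i ×ˢ Q.part j := by
  rw [← Q.P_cover i j]
  exact Finset.subset_biUnion_of_mem (Q.P i j) (Finset.mem_univ a)

/-- The bigraph `(V_i, V_j; P_ij^a)`. -/
def bigraph (Q : Decomposition V t l) (i j : Fin t) (a : Fin l) : Bigraph α α :=
  ⟨Q.part i, Q.part j, Q.P i j a, Q.P_sub i j a⟩

/-- The triad `(V_i, V_j, V_k; P_ij^a, P_ik^b, P_jk^c)`. -/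
def triad (Q : Decomposition V t l) (i j k : Fin t) (a b c : Fin l) : Triad α where
  X := Q.part i
  Y := Q.part j
  Z := Q.part k
  EXY := Q.P i j a
  EXZ := Q.P i k b
  EYZ := Q.P j k c
  EXY_sub := Q.P_sub i j a
  EXZ_sub := Q.P_sub i k b
  EYZ_sub := Q.P_sub j k c

open Classical in
/-- `Q` is a `(t, ℓ, ε₁, ε₂)`-decomposition: at least `(1 - ε₁)|V|²` pairs lie in a class
having `dev₂(ε₂)`. -/
def IsQuasirandom (Q : Decomposition V t l) (ε₁ ε₂ : ℝ) : Prop :=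
  (1 - ε₁) * (V.card : ℝ) ^ 2 ≤
    (((V ×ˢ V).filter fun p =>
      ∃ i j a, p ∈ Q.P i j a ∧ (Q.bigraph i j a).HasDev2 ε₂).card : ℝ)

open Classical in
/-- All but at most `ε₁|V|³` triples lie in `K₃(G)` for some triad `G` of `Q` that has
`dev_{2,3}(ε₁, ε₂)` with respect to `H`. -/
def IsTripleRegular (H : ThreeGraph α) (Q : Decomposition H.verts t l) (ε₁ ε₂ : ℝ) : Prop :=
  (((H.verts ×ˢ H.verts ×ˢ H.verts).filter fun p =>
      ¬ ∃ i j k a b c, p ∈ (Q.triad i j k a b c).K3 ∧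
        (H.bar.restrict (Q.triad i j k a b c)).HasDev23 (Q.triad i j k a b c) ε₁ ε₂).card : ℝ)
    ≤ ε₁ * (H.verts.card : ℝ) ^ 3

/-- `Q` is a `dev_{2,3}(ε₁, ε₂)`-regular `(t, ℓ, ε₁, ε₂)`-decomposition for `H`. -/
def IsRegularDecomposition (H : ThreeGraph α) (Q : Decomposition H.verts t l) (ε₁ ε₂ : ℝ) :
    Prop :=
  Q.IsQuasirandom ε₁ ε₂ ∧ IsTripleRegular H Q ε₁ ε₂

end Decomposition

/-- The set `K₂[A, B]` of unordered pairs `{x, y}` with `x ∈ A`, `y ∈ B`, `x ≠ y`. -/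
def K2 {α : Type*} [DecidableEq α] (A B : Finset α) : Finset (Finset α) :=
  ((A ×ˢ B).filter fun p => p.1 ≠ p.2).image fun p => {p.1, p.2}

/-- The density `d_G(X, Y)` of a set `F` of unordered pairs (the edge set of a graph `G`). -/
def pairDensity {α : Type*} [DecidableEq α] (F : Finset (Finset α)) (X Y : Finset α) : ℝ :=
  (((X ×ˢ Y).filter fun p => ({p.1, p.2} : Finset α) ∈ F).card : ℝ) /
    ((X.card : ℝ) * (Y.card : ℝ))

/-- The bipartite graph `(A ∪ B, F)` is `ε`-regular. -/
def IsEpsRegular {α : Type*} [DecidableEq α] (A B : Finset α) (F : Finset (Finset α)) (ε : ℝ) :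
    Prop :=
  ∀ A' ⊆ A, ∀ B' ⊆ B, ε * (A.card : ℝ) ≤ (A'.card : ℝ) → ε * (B.card : ℝ) ≤ (B'.card : ℝ) →
    |pairDensity F A B - pairDensity F A' B'| ≤ ε

/-- A bipartite `U`-colored graph `(A ∪ B, (P_u)_{u ∈ U})`: `A` and `B` are disjoint, and
`K₂[A, B]` is the disjoint union of the colour classes `P_u`, `u ∈ U`. -/
structure ColoredGraph (α : Type*) {υ : Type*} [DecidableEq α] (U : Finset υ) where
  A : Finset α
  B : Finset α
  A_disjoint_B : Disjoint A B
  P : υ → Finset (Finset α)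
  P_disjoint : ∀ u ∈ U, ∀ u' ∈ U, u ≠ u' → Disjoint (P u) (P u')
  P_cover : U.biUnion P = K2 A B

/-- `H` is an `(m, Γ)`-blowup of `G = (U, V; E)`, with new vertex classes `C_v`, `v ∈ V`.  The
edges of `H` that do not meet all three of `A`, `B`, `⋃ C_v` are arbitrary. -/
structure IsBlowup {α υ ν : Type*} [DecidableEq α] (G : Bigraph υ ν)
    (Γ : ColoredGraph α G.left) (m : ℕ) (C : ν → Finset α) (H : ThreeGraph α) : Prop where
  card_C : ∀ v ∈ G.right, (C v).card = m
  C_disjoint : ∀ v ∈ G.right, ∀ w ∈ G.right, v ≠ w → Disjoint (C v) (C w)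
  C_new : ∀ v ∈ G.right, Disjoint (C v) (Γ.A ∪ Γ.B)
  verts_eq : H.verts = Γ.A ∪ Γ.B ∪ G.right.biUnion C
  edge : ∀ u ∈ G.left, ∀ v ∈ G.right, (u, v) ∈ G.E →
    ∀ x y z, ({x, y} : Finset α) ∈ Γ.P u → z ∈ C v → ({x, y, z} : Finset α) ∈ H.edges
  non_edge : ∀ u ∈ G.left, ∀ v ∈ G.right, (u, v) ∉ G.E →
    ∀ x y z, ({x, y} : Finset α) ∈ Γ.P u → z ∈ C v → ({x, y, z} : Finset α) ∉ H.edges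

end TripleReg

end

open TripleReg

/-! Fix a class `P` of pairs between two parts `A_i`, `B_j`, and a vertex `v ∈ V`. For `z ∈ C_v`,
whether `xyz` is an edge depends only on whether the colour of `xy` lies in `N¹(v)`. A regular triad
over `P` in which `C_v` fills a fair share of the third part forces this dependence to be nearly
constant. Round the relative density `D` of the triad to 0 or 1 and call a pair wrong if its type
disagrees. On all triangles over wrong pairs with apex in `C_v` the balanced function takes one
value `c`, with `|c| ≥ 1/2`. A small octahedron sum makes such triangles rare, by Cauchy–Schwarz
(`octahedron_inequalities`). Yet most pairs have about the expected number of common neighbours in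
`C_v` (`sum_abs_codegree_sub_le`), so wrong pairs are rare. This is `Trigraph.HasDev23.dichotomy`,
and the rounded value is `f(α, v)`.

The Cauchy–Schwarz steps may not lose density factors: `ε₁` is fixed before `ℓ`, while the densities
can shrink as `ℓ` grows. The edge indicators of the bigraphs are therefore kept as weights, and
their quasirandomness counts the resulting cherries and four-cycles.

The triads come from averaging. Irregular triples are rare, so some pair of large parts carries few
of them (`exists_big_parts`), and most pairs between these parts lie in classes that are not small
and carry few of them (`le_card_biUnion_good_classes`). Over such a class and every `v`, one typical
triple produces a usable triad (`exists_typical_triple`). Since no `v` is excluded, every `𝒞_α` is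
all of `V`; the union bound over `v` is paid for by `ε₁ < |V|^(-D)`. -/

namespace TripleReg

open Finset

/-! ### Box sums, cut norms, and counts of cherries and four-cycles -/

section Analytic

variable {α β γ : Type*}

/-- The box sum of `g` written as a sum of squared correlations of rows. -/
theorem boxSum_eq_rows (X : Finset α) (Z : Finset γ) (g : α → γ → ℝ) :
    ∑ x₀ ∈ X, ∑ x₁ ∈ X, ∑ z₀ ∈ Z, ∑ z₁ ∈ Z,
        (g x₀ z₀ * g x₀ z₁) * (g x₁ z₀ * g x₁ z₁) =
      ∑ x₀ ∈ X, ∑ x₁ ∈ X, (∑ z ∈ Z, g x₀ z * g x₁ z) ^ 2 := by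
  refine sum_congr rfl fun x₀ _ => sum_congr rfl fun x₁ _ => ?_
  rw [sq, sum_mul_sum]
  exact sum_congr rfl fun z₀ _ => sum_congr rfl fun z₁ _ => by ring

/-- The box sum of `g` written as a sum of squared correlations of columns. -/
theorem boxSum_eq_columns (X : Finset α) (Z : Finset γ) (g : α → γ → ℝ) :
    ∑ x₀ ∈ X, ∑ x₁ ∈ X, ∑ z₀ ∈ Z, ∑ z₁ ∈ Z,
        (g x₀ z₀ * g x₀ z₁) * (g x₁ z₀ * g x₁ z₁) =
      ∑ z₀ ∈ Z, ∑ z₁ ∈ Z, (∑ x ∈ X, g x z₀ * g x z₁) ^ 2 := by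
  simp_rw [sq, sum_mul_sum]
  calc _ = ∑ x₀ ∈ X, ∑ z₀ ∈ Z, ∑ z₁ ∈ Z, ∑ x₁ ∈ X,
        (g x₀ z₀ * g x₀ z₁) * (g x₁ z₀ * g x₁ z₁) := by
        refine sum_congr rfl fun x₀ _ => ?_
        rw [sum_comm]
        exact sum_congr rfl fun z₀ _ => sum_comm
    _ = _ := by
        rw [sum_comm]
        exact sum_congr rfl fun z₀ _ => sum_comm

theorem sq_sum_sum_le (X : Finset α) (Z : Finset γ) (F : α → γ → ℝ) :
    (∑ x ∈ X, ∑ z ∈ Z, F x z) ^ 2 ≤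
      (X.card : ℝ) * Z.card * ∑ x ∈ X, ∑ z ∈ Z, F x z ^ 2 := by
  have h := sq_sum_le_card_mul_sum_sq (s := X ×ˢ Z) (f := fun p => F p.1 p.2)
  simpa [sum_product, card_product] using h

/-- The square of a sum over rows of a function with small box sum. -/
theorem sum_row_sq_le {X : Finset α} {Z : Finset γ} {g : α → γ → ℝ} {b : γ → ℝ} {s : ℝ}
    (hb : ∀ z, |b z| ≤ 1)
    (hg : ∑ x₀ ∈ X, ∑ x₁ ∈ X, ∑ z₀ ∈ Z, ∑ z₁ ∈ Z,
        (g x₀ z₀ * g x₀ z₁) * (g x₁ z₀ * g x₁ z₁) ≤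
      s ^ 4 * (X.card : ℝ) ^ 2 * (Z.card : ℝ) ^ 2) :
    ∑ x ∈ X, (∑ z ∈ Z, b z * g x z) ^ 2 ≤ s ^ 2 * X.card * (Z.card : ℝ) ^ 2 := by
  rw [boxSum_eq_columns] at hg
  have h1 : ∑ x ∈ X, (∑ z ∈ Z, b z * g x z) ^ 2 =
      ∑ z₀ ∈ Z, ∑ z₁ ∈ Z, b z₀ * b z₁ * ∑ x ∈ X, g x z₀ * g x z₁ := by
    simp_rw [sq, sum_mul_sum, mul_sum]
    rw [sum_comm]
    refine sum_congr rfl fun z₀ _ => ?_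
    rw [sum_comm]
    exact sum_congr rfl fun z₁ _ => sum_congr rfl fun x _ => by ring
  have h2 := sq_sum_sum_le Z Z fun z₀ z₁ => b z₀ * b z₁ * ∑ x ∈ X, g x z₀ * g x z₁
  rw [← h1] at h2
  have h3 : ∑ z₀ ∈ Z, ∑ z₁ ∈ Z, (b z₀ * b z₁ * ∑ x ∈ X, g x z₀ * g x z₁) ^ 2 ≤
      ∑ z₀ ∈ Z, ∑ z₁ ∈ Z, (∑ x ∈ X, g x z₀ * g x z₁) ^ 2 := by
    refine sum_le_sum fun z₀ _ => sum_le_sum fun z₁ _ => ?_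
    rw [mul_pow]
    refine mul_le_of_le_one_left (sq_nonneg _) ?_
    rw [sq_le_one_iff_abs_le_one, abs_mul]
    exact mul_le_one₀ (hb _) (abs_nonneg _) (hb _)
  refine le_of_sq_le_sq ?_ (by positivity)
  calc _ ≤ _ := h2
    _ ≤ (Z.card : ℝ) * Z.card * (s ^ 4 * (X.card : ℝ) ^ 2 * (Z.card : ℝ) ^ 2) := by
        gcongr; exact h3.trans hg
    _ = _ := by ring

/-- A function with small box sum has small cut norm. -/
theorem abs_sum_mul_mul_le {X : Finset α} {Z : Finset γ} {g : α → γ → ℝ}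
    {a : α → ℝ} {b : γ → ℝ} {s : ℝ} (hs : 0 ≤ s)
    (ha : ∀ x, |a x| ≤ 1) (hb : ∀ z, |b z| ≤ 1)
    (hg : ∑ x₀ ∈ X, ∑ x₁ ∈ X, ∑ z₀ ∈ Z, ∑ z₁ ∈ Z,
        (g x₀ z₀ * g x₀ z₁) * (g x₁ z₀ * g x₁ z₁) ≤
      s ^ 4 * (X.card : ℝ) ^ 2 * (Z.card : ℝ) ^ 2) :
    |∑ x ∈ X, a x * ∑ z ∈ Z, b z * g x z| ≤ s * X.card * Z.card := by
  refine abs_le_of_sq_le_sq ?_ (by positivity)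
  calc _ ≤ (∑ x ∈ X, a x ^ 2) * ∑ x ∈ X, (∑ z ∈ Z, b z * g x z) ^ 2 :=
        sum_mul_sq_le_sq_mul_sq _ _ _
    _ ≤ (X.card : ℝ) * (s ^ 2 * X.card * (Z.card : ℝ) ^ 2) := by
        gcongr
        · calc ∑ x ∈ X, a x ^ 2 ≤ ∑ x ∈ X, (1 : ℝ) :=
              sum_le_sum fun x _ => (sq_le_one_iff_abs_le_one _).2 (ha x)
            _ = _ := by simp
        · exact sum_row_sq_le hb hg
    _ = _ := by ring

/-- A function with small box sum has small row sums in `ℓ¹`. -/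
theorem sum_abs_row_le {X : Finset α} {Z : Finset γ} {g : α → γ → ℝ} {b : γ → ℝ} {s : ℝ}
    (hs : 0 ≤ s) (hb : ∀ z, |b z| ≤ 1)
    (hg : ∑ x₀ ∈ X, ∑ x₁ ∈ X, ∑ z₀ ∈ Z, ∑ z₁ ∈ Z,
        (g x₀ z₀ * g x₀ z₁) * (g x₁ z₀ * g x₁ z₁) ≤
      s ^ 4 * (X.card : ℝ) ^ 2 * (Z.card : ℝ) ^ 2) :
    ∑ x ∈ X, |∑ z ∈ Z, b z * g x z| ≤ s * X.card * Z.card := by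
  -- Testing the cut norm against the signs of the row sums turns it into an `ℓ¹` bound.
  have h := abs_sum_mul_mul_le (a := fun x => (SignType.sign (∑ z ∈ Z, b z * g x z) : ℝ))
    hs (fun x => ?_) hb hg
  · simp_rw [sign_mul_self] at h
    exact (le_abs_self _).trans h
  · rcases lt_trichotomy (∑ z ∈ Z, b z * g x z) 0 with h | h | h <;> simp [h]

/-- Upper bound for the number of cherries of a quasirandom bigraph. -/
theorem sum_degree_sq_le {X : Finset α} {Z : Finset γ} {g : α → γ → ℝ} {d s : ℝ}
    (hs : 0 ≤ s) (hsd : s ≤ d)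
    (hg : ∑ x₀ ∈ X, ∑ x₁ ∈ X, ∑ z₀ ∈ Z, ∑ z₁ ∈ Z,
        (g x₀ z₀ * g x₀ z₁) * (g x₁ z₀ * g x₁ z₁) ≤
      s ^ 4 * (X.card : ℝ) ^ 2 * (Z.card : ℝ) ^ 2) :
    ∑ x ∈ X, (∑ z ∈ Z, (d + g x z)) ^ 2 ≤ 4 * d ^ 2 * X.card * (Z.card : ℝ) ^ 2 := by
  have h1 := sum_row_sq_le (b := fun _ => 1) (by simp) hg
  simp only [one_mul] at h1
  calc _ ≤ ∑ x ∈ X, (2 * (d * Z.card) ^ 2 + 2 * (∑ z ∈ Z, g x z) ^ 2) := by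
        refine sum_le_sum fun x _ => ?_
        rw [sum_add_distrib, sum_const, nsmul_eq_mul]
        nlinarith [sq_nonneg (d * Z.card - ∑ z ∈ Z, g x z)]
    _ = 2 * d ^ 2 * X.card * (Z.card : ℝ) ^ 2 + 2 * ∑ x ∈ X, (∑ z ∈ Z, g x z) ^ 2 := by
        rw [sum_add_distrib, ← mul_sum, ← mul_sum, sum_const, nsmul_eq_mul]; ring
    _ ≤ 2 * d ^ 2 * X.card * (Z.card : ℝ) ^ 2 + 2 * (d ^ 2 * X.card * (Z.card : ℝ) ^ 2) := by
        have : s ^ 2 * X.card * (Z.card : ℝ) ^ 2 ≤ d ^ 2 * X.card * (Z.card : ℝ) ^ 2 := by gcongr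
        linarith
    _ = _ := by ring

/-- Upper bound for the number of four-cycles of a quasirandom bigraph. -/
theorem sum_codegree_sq_le {Y : Finset β} {Z : Finset γ} {g : β → γ → ℝ} {d s : ℝ}
    (hs : 0 ≤ s) (hsd : s ≤ d)
    (hg : ∑ y₀ ∈ Y, ∑ y₁ ∈ Y, ∑ z₀ ∈ Z, ∑ z₁ ∈ Z,
        (g y₀ z₀ * g y₀ z₁) * (g y₁ z₀ * g y₁ z₁) ≤
      s ^ 4 * (Y.card : ℝ) ^ 2 * (Z.card : ℝ) ^ 2) :
    ∑ y₀ ∈ Y, ∑ y₁ ∈ Y, (∑ z ∈ Z, (d + g y₀ z) * (d + g y₁ z)) ^ 2 ≤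
      16 * d ^ 4 * (Y.card : ℝ) ^ 2 * (Z.card : ℝ) ^ 2 := by
  have h1 := sum_row_sq_le (b := fun _ => 1) (by simp) hg
  simp only [one_mul] at h1
  rw [boxSum_eq_rows] at hg
  set R : β → ℝ := fun y => ∑ z ∈ Z, g y z with hR
  set K : β → β → ℝ := fun y₀ y₁ => ∑ z ∈ Z, g y₀ z * g y₁ z with hK
  -- The codegree splits into a main term, two degree deviations (controlled by `h1`) and the row
  -- correlation `K`, whose squares sum to the box sum.
  have e (y₀ y₁ : β) : ∑ z ∈ Z, (d + g y₀ z) * (d + g y₁ z) =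
      d ^ 2 * Z.card + d * R y₁ + d * R y₀ + K y₀ y₁ := by
    simp only [hR, hK, mul_sum]
    rw [mul_comm (d ^ 2), ← nsmul_eq_mul, ← sum_const, ← sum_add_distrib, ← sum_add_distrib,
      ← sum_add_distrib]
    exact sum_congr rfl fun z _ => by ring
  have q (a b c k : ℝ) : (a + b + c + k) ^ 2 ≤ 4 * (a ^ 2 + b ^ 2 + c ^ 2 + k ^ 2) := by
    nlinarith [sq_nonneg (a - b), sq_nonneg (a - c), sq_nonneg (a - k), sq_nonneg (b - c),
      sq_nonneg (b - k), sq_nonneg (c - k)]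
  calc _ ≤ ∑ y₀ ∈ Y, ∑ y₁ ∈ Y, 4 * ((d ^ 2 * Z.card) ^ 2 + (d * R y₁) ^ 2 + (d * R y₀) ^ 2 +
        K y₀ y₁ ^ 2) := by
        refine sum_le_sum fun y₀ _ => sum_le_sum fun y₁ _ => ?_
        rw [e]
        exact q _ _ _ _
    _ = 4 * (d ^ 4 * (Y.card : ℝ) ^ 2 * (Z.card : ℝ) ^ 2 + 2 * d ^ 2 * Y.card * ∑ y ∈ Y, R y ^ 2 +
        ∑ y₀ ∈ Y, ∑ y₁ ∈ Y, K y₀ y₁ ^ 2) := by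
        simp only [← mul_sum, sum_add_distrib, sum_const, nsmul_eq_mul, mul_pow]
        ring
    _ ≤ 4 * (d ^ 4 * (Y.card : ℝ) ^ 2 * (Z.card : ℝ) ^ 2 +
        2 * d ^ 2 * Y.card * (d ^ 2 * Y.card * (Z.card : ℝ) ^ 2) +
        d ^ 4 * (Y.card : ℝ) ^ 2 * (Z.card : ℝ) ^ 2) := by
        gcongr
        · refine h1.trans ?_
          gcongr
        · refine hg.trans ?_
          gcongr
    _ = _ := by ring

end Analytic

/-! ### Octahedron sums and weighted codegrees -/

section Octahedron

variable {α β γ : Type*}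

/-- One Cauchy–Schwarz step on a sum over pairs with a weight. -/
theorem sq_sum_sum_mul_le (X : Finset α) (Y : Finset β) (a F : α → β → ℝ) :
    (∑ x ∈ X, ∑ y ∈ Y, a x y * F x y) ^ 2 ≤
      (∑ x ∈ X, ∑ y ∈ Y, a x y ^ 2) * ∑ x ∈ X, ∑ y ∈ Y, F x y ^ 2 := by
  have h := sum_mul_sq_le_sq_mul_sq (X ×ˢ Y) (fun p => a p.1 p.2) (fun p => F p.1 p.2)
  simpa only [sum_product] using h

theorem sum_mul_sum_sq_eq (X : Finset α) (Z : Finset γ) (u : α → γ → ℝ) :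
    ∑ x ∈ X, (∑ z ∈ Z, u x z) ^ 2 = ∑ x ∈ X, ∑ z₀ ∈ Z, ∑ z₁ ∈ Z, u x z₀ * u x z₁ := by
  simp_rw [sq, sum_mul_sum]

/-- Three applications of Cauchy–Schwarz: a function supported on the triangles of a triad is
controlled by its octahedron sum. -/
theorem octahedron_inequalities {X : Finset α} {Y : Finset β} {Z : Finset γ}
    {h : α → β → γ → ℝ} {a : α → β → ℝ} {q : α → γ → ℝ} {r : β → γ → ℝ} {b : γ → ℝ}
    {A Q R O : ℝ}
    (hq : ∀ x z, 0 ≤ q x z ∧ q x z ≤ 1) (hr : ∀ y z, 0 ≤ r y z ∧ r y z ≤ 1)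
    (hb : ∀ z, 0 ≤ b z ∧ b z ≤ 1)
    (hqh : ∀ x y z, q x z * h x y z = h x y z) (hrh : ∀ x y z, r y z * h x y z = h x y z)
    (hA : ∑ x ∈ X, ∑ y ∈ Y, a x y ^ 2 ≤ A)
    (hQ : ∑ x ∈ X, (∑ z ∈ Z, q x z) ^ 2 ≤ Q)
    (hR : ∑ y₀ ∈ Y, ∑ y₁ ∈ Y, (∑ z ∈ Z, r y₀ z * r y₁ z) ^ 2 ≤ R)
    (hO : ∑ x₀ ∈ X, ∑ x₁ ∈ X, ∑ y₀ ∈ Y, ∑ y₁ ∈ Y, ∑ z₀ ∈ Z, ∑ z₁ ∈ Z,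
        ((h x₀ y₀ z₀ * h x₀ y₀ z₁) * (h x₀ y₁ z₀ * h x₀ y₁ z₁)) *
          ((h x₁ y₀ z₀ * h x₁ y₀ z₁) * (h x₁ y₁ z₀ * h x₁ y₁ z₁)) ≤ O) :
    (∑ x ∈ X, ∑ y ∈ Y, a x y * ∑ z ∈ Z, b z * h x y z) ^ 8 ≤ A ^ 4 * Q ^ 2 * R * O := by
  set S := ∑ x ∈ X, ∑ y ∈ Y, a x y * ∑ z ∈ Z, b z * h x y z with hS
  set T₁ := ∑ x ∈ X, ∑ y ∈ Y, (∑ z ∈ Z, b z * h x y z) ^ 2 with hT₁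
  set T₂ := ∑ x ∈ X, ∑ z₀ ∈ Z, ∑ z₁ ∈ Z, (∑ y ∈ Y, h x y z₀ * h x y z₁) ^ 2 with hT₂
  have hA0 : 0 ≤ A := le_trans (sum_nonneg fun _ _ => sum_nonneg fun _ _ => sq_nonneg _) hA
  have hT₁0 : 0 ≤ T₁ := sum_nonneg fun _ _ => sum_nonneg fun _ _ => sq_nonneg _
  have hT₂0 : 0 ≤ T₂ :=
    sum_nonneg fun _ _ => sum_nonneg fun _ _ => sum_nonneg fun _ _ => sq_nonneg _
  have hQ0 : 0 ≤ Q := le_trans (sum_nonneg fun _ _ => sq_nonneg _) hQ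
  have s1 : S ^ 2 ≤ A * T₁ :=
    (sq_sum_sum_mul_le X Y a fun x y => ∑ z ∈ Z, b z * h x y z).trans (by gcongr)
  -- Since `h = q h`, both factors `q x z₀`, `q x z₁` can stay in the weight. Its square sum is then
  -- at most the number of cherries `Q` rather than `|X||Z|²`.
  have s2 : T₁ ^ 2 ≤ Q * T₂ := by
    have e : T₁ = ∑ x ∈ X, ∑ w ∈ Z ×ˢ Z, (b w.1 * q x w.1 * (b w.2 * q x w.2)) *
        ∑ y ∈ Y, h x y w.1 * h x y w.2 := by
      rw [hT₁]
      refine sum_congr rfl fun x _ => ?_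
      rw [sum_mul_sum_sq_eq, sum_product, sum_comm]
      refine sum_congr rfl fun z₀ _ => ?_
      rw [sum_comm]
      refine sum_congr rfl fun z₁ _ => ?_
      rw [mul_sum]
      refine sum_congr rfl fun y _ => ?_
      calc _ = b z₀ * b z₁ * (h x y z₀ * h x y z₁) := by ring
        _ = b z₀ * b z₁ * ((q x z₀ * h x y z₀) * (q x z₁ * h x y z₁)) := by rw [hqh, hqh]
        _ = _ := by ring
    rw [e]
    refine (sq_sum_sum_mul_le X (Z ×ˢ Z) _ _).trans ?_
    have e2 : ∑ x ∈ X, ∑ w ∈ Z ×ˢ Z, (∑ y ∈ Y, h x y w.1 * h x y w.2) ^ 2 = T₂ := by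
      simp only [sum_product, hT₂]
    rw [e2]
    gcongr
    refine le_trans ?_ hQ
    rw [sum_mul_sum_sq_eq]
    simp only [sum_product]
    refine sum_le_sum fun x _ => sum_le_sum fun z₀ _ => sum_le_sum fun z₁ _ => ?_
    have k (z : γ) : 0 ≤ b z * q x z ∧ b z * q x z ≤ q x z ∧ b z * q x z ≤ 1 := by
      refine ⟨mul_nonneg (hb z).1 (hq x z).1, mul_le_of_le_one_left (hq x z).1 (hb z).2,
        mul_le_one₀ (hb z).2 (hq x z).1 (hq x z).2⟩
    calc _ ≤ b z₀ * q x z₀ * (b z₁ * q x z₁) :=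
          pow_le_of_le_one (mul_nonneg (k z₀).1 (k z₁).1)
            (mul_le_one₀ (k z₀).2.2 (k z₁).1 (k z₁).2.2) two_ne_zero
      _ ≤ _ := mul_le_mul (k z₀).2.1 (k z₁).2.1 (k z₁).1 (hq x z₀).1
  -- The same device with `r`: the weight `ρ` is supported on four-cycles between `Y` and `Z`, and
  -- duplicating `x` completes the octahedron.
  have s3 : T₂ ^ 2 ≤ R * O := by
    set B : α → (β × β) × (γ × γ) → ℝ := fun x w =>
      (h x w.1.1 w.2.1 * h x w.1.1 w.2.2) * (h x w.1.2 w.2.1 * h x w.1.2 w.2.2) with hB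
    set ρ : (β × β) × (γ × γ) → ℝ := fun w =>
      (r w.1.1 w.2.1 * r w.1.1 w.2.2) * (r w.1.2 w.2.1 * r w.1.2 w.2.2) with hρ
    set W := (Y ×ˢ Y) ×ˢ (Z ×ˢ Z) with hW
    have hρB (x : α) (w) : ρ w * B x w = B x w := by
      simp only [hρ, hB]
      calc _ = (r w.1.1 w.2.1 * h x w.1.1 w.2.1 * (r w.1.1 w.2.2 * h x w.1.1 w.2.2)) *
            (r w.1.2 w.2.1 * h x w.1.2 w.2.1 * (r w.1.2 w.2.2 * h x w.1.2 w.2.2)) := by ring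
        _ = _ := by simp only [hrh]
    have e : T₂ = ∑ w ∈ W, ρ w * ∑ x ∈ X, B x w := by
      simp_rw [mul_sum, hρB]
      rw [sum_comm, hT₂]
      refine sum_congr rfl fun x _ => ?_
      rw [← boxSum_eq_columns]
      simp only [hW, hB, sum_product]
    have e2 : ∑ w ∈ W, (∑ x ∈ X, B x w) ^ 2 ≤ O := by
      refine le_trans (le_of_eq ?_) hO
      simp_rw [sq, sum_mul_sum]
      rw [sum_comm]
      refine sum_congr rfl fun x₀ _ => ?_
      rw [sum_comm]
      refine sum_congr rfl fun x₁ _ => ?_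
      simp only [hW, hB, sum_product]
    have e3 : ∑ w ∈ W, ρ w ^ 2 ≤ R := by
      refine le_trans ?_ hR
      rw [← boxSum_eq_rows]
      simp only [hW, hρ, sum_product]
      refine sum_le_sum fun y₀ _ => sum_le_sum fun y₁ _ => sum_le_sum fun z₀ _ =>
        sum_le_sum fun z₁ _ => ?_
      have k {u v : ℝ} (hu : 0 ≤ u ∧ u ≤ 1) (hv : 0 ≤ v ∧ v ≤ 1) : 0 ≤ u * v ∧ u * v ≤ 1 :=
        ⟨mul_nonneg hu.1 hv.1, mul_le_one₀ hu.2 hv.1 hv.2⟩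
      have := k (k (hr y₀ z₀) (hr y₀ z₁)) (k (hr y₁ z₀) (hr y₁ z₁))
      exact pow_le_of_le_one this.1 this.2 two_ne_zero
    rw [e]
    refine (sum_mul_sq_le_sq_mul_sq W ρ _).trans ?_
    exact mul_le_mul e3 e2 (sum_nonneg fun _ _ => sq_nonneg _)
      ((sum_nonneg fun _ _ => sq_nonneg _).trans e3)
  calc S ^ 8 = (S ^ 2) ^ 4 := by ring
    _ ≤ (A * T₁) ^ 4 := by gcongr
    _ = A ^ 4 * (T₁ ^ 2) ^ 2 := by ring
    _ ≤ A ^ 4 * (Q * T₂) ^ 2 := by gcongr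
    _ = A ^ 4 * Q ^ 2 * T₂ ^ 2 := by ring
    _ ≤ A ^ 4 * Q ^ 2 * (R * O) := by gcongr
    _ = _ := by ring

/-- In a pair of quasirandom bigraphs, the weighted codegrees are close to their expected value
on average. -/
theorem sum_abs_codegree_sub_le {X : Finset α} {Y : Finset β} {Z : Finset γ}
    {g : α → γ → ℝ} {g' : β → γ → ℝ} {b : γ → ℝ} {d d' s : ℝ} (hs : 0 ≤ s)
    (hd : 0 ≤ d ∧ d ≤ 1) (hg' : ∀ y z, |d' + g' y z| ≤ 1)
    (hb : ∀ z, |b z| ≤ 1)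
    (hg : ∑ x₀ ∈ X, ∑ x₁ ∈ X, ∑ z₀ ∈ Z, ∑ z₁ ∈ Z,
        (g x₀ z₀ * g x₀ z₁) * (g x₁ z₀ * g x₁ z₁) ≤
      s ^ 4 * (X.card : ℝ) ^ 2 * (Z.card : ℝ) ^ 2)
    (hgg : ∑ y₀ ∈ Y, ∑ y₁ ∈ Y, ∑ z₀ ∈ Z, ∑ z₁ ∈ Z,
        (g' y₀ z₀ * g' y₀ z₁) * (g' y₁ z₀ * g' y₁ z₁) ≤
      s ^ 4 * (Y.card : ℝ) ^ 2 * (Z.card : ℝ) ^ 2) :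
    ∑ x ∈ X, ∑ y ∈ Y, |∑ z ∈ Z, b z * ((d + g x z) * (d' + g' y z)) - d * d' * ∑ z ∈ Z, b z| ≤
      2 * s * X.card * Y.card * Z.card := by
  have e (x : α) (y : β) :
      ∑ z ∈ Z, b z * ((d + g x z) * (d' + g' y z)) - d * d' * ∑ z ∈ Z, b z =
        ∑ z ∈ Z, (b z * (d' + g' y z)) * g x z + d * ∑ z ∈ Z, b z * g' y z := by
    simp only [mul_sum]
    rw [← sum_sub_distrib, ← sum_add_distrib]
    exact sum_congr rfl fun z _ => by ring
  calc _ ≤ ∑ x ∈ X, ∑ y ∈ Y, (|∑ z ∈ Z, (b z * (d' + g' y z)) * g x z| +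
        |∑ z ∈ Z, b z * g' y z|) := by
        refine sum_le_sum fun x _ => sum_le_sum fun y _ => ?_
        rw [e]
        refine (abs_add_le _ _).trans ?_
        refine add_le_add le_rfl ?_
        rw [abs_mul, abs_of_nonneg hd.1]
        exact mul_le_of_le_one_left (abs_nonneg _) hd.2
    _ = ∑ y ∈ Y, ∑ x ∈ X, |∑ z ∈ Z, (b z * (d' + g' y z)) * g x z| +
        ∑ x ∈ X, ∑ y ∈ Y, |∑ z ∈ Z, b z * g' y z| := by
        simp only [sum_add_distrib]
        rw [sum_comm]
    _ ≤ ∑ y ∈ Y, s * X.card * Z.card + ∑ x ∈ X, s * Y.card * Z.card := by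
        gcongr with y _ x _
        · refine sum_abs_row_le hs (fun z => ?_) hg
          rw [abs_mul]
          exact mul_le_one₀ (hb z) (abs_nonneg _) (hg' y z)
        · exact sum_abs_row_le hs hb hgg
    _ = _ := by
        simp only [sum_const, nsmul_eq_mul]; ring

end Octahedron

/-! ### Densities of bigraphs -/

namespace Bigraph

variable {α β : Type*}

theorem density_nonneg (G : Bigraph α β) : 0 ≤ G.density := by
  unfold density; positivity

theorem density_le_one (G : Bigraph α β) : G.density ≤ 1 := by
  refine div_le_one_of_le₀ ?_ (by positivity)
  exact_mod_cast (card_le_card G.E_sub).trans_eq (card_product _ _)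

theorem density_mul_card (G : Bigraph α β) :
    G.density * G.left.card * G.right.card = G.E.card := by
  rcases eq_or_ne ((G.left.card : ℝ) * G.right.card) 0 with h | h
  · have h1 : (G.E.card : ℝ) ≤ G.left.card * G.right.card := by
      exact_mod_cast (card_le_card G.E_sub).trans_eq (card_product _ _)
    have h2 : (0 : ℝ) ≤ G.E.card := by positivity
    rw [mul_assoc, h, mul_zero]
    linarith
  · rw [mul_assoc, density, div_mul_cancel₀ _ h]

variable [DecidableEq α] [DecidableEq β]

/-- Lets the estimates above, stated for `d + g`, be read as statements about edge indicators. -/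
theorem density_add_balanced (G : Bigraph α β) (x : α) (y : β) :
    G.density + G.balanced x y = if (x, y) ∈ G.E then 1 else 0 := by
  unfold balanced; split_ifs <;> ring

/-- Passes to the fourth root `s` of the deviation parameter, the scale on which cut norms are
small. -/
theorem HasDev2With.boxSum_le {G : Bigraph α β} {η d s : ℝ} (h : G.HasDev2With η d)
    (hη : η ≤ s ^ 4) :
    ∑ x₀ ∈ G.left, ∑ x₁ ∈ G.left, ∑ z₀ ∈ G.right, ∑ z₁ ∈ G.right,
        (G.balanced x₀ z₀ * G.balanced x₀ z₁) * (G.balanced x₁ z₀ * G.balanced x₁ z₁) ≤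
      s ^ 4 * (G.left.card : ℝ) ^ 2 * (G.right.card : ℝ) ^ 2 := by
  have h2 := h.2
  simp only [Fin.prod_univ_two, Matrix.cons_val_zero, Matrix.cons_val_one] at h2
  refine h2.trans ?_
  gcongr

end Bigraph

/-! ### Regular triads force near-constancy -/

section Dichotomy

variable {α : Type*} [DecidableEq α]

/-- In a regular triad, sums of the balanced function against bounded weights are small. -/
theorem Trigraph.HasDev23.abs_weighted_sum_le {H : Trigraph α} {G : Triad α} {η r s : ℝ}
    (hG : H.HasDev23 G (r ^ 8) η) (hr : 0 ≤ r) (hs : 0 ≤ s) (hη : η ≤ s ^ 4)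
    (h1 : s ≤ G.compXY.density) (h2 : s ≤ G.compXZ.density) (h3 : s ≤ G.compYZ.density)
    {a : α → α → ℝ} {b : α → ℝ}
    (ha : ∑ x ∈ G.X, ∑ y ∈ G.Y, a x y ^ 2 ≤ G.compXY.density * G.X.card * G.Y.card)
    (hb : ∀ z, 0 ≤ b z ∧ b z ≤ 1) :
    |∑ x ∈ G.X, ∑ y ∈ G.Y, a x y * ∑ z ∈ G.Z, b z * H.balanced G x y z| ≤
      8 * r * (G.compXY.density * G.compXZ.density * G.compYZ.density) *
        (G.X.card * G.Y.card * G.Z.card) := by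
  obtain ⟨-, d₁, d₃, d₂, hd₁, hd₃, hd₂, hXY, hXZ, hYZ, hO⟩ := hG
  have hs1 : s ≤ 1 := h1.trans (Bigraph.density_le_one _)
  have hηs : η ≤ s := hη.trans (pow_le_of_le_one hs hs1 (by norm_num))
  have hQ := sum_degree_sq_le hs h2 (hXZ.boxSum_le hη)
  have hR := sum_codegree_sq_le hs h3 (hYZ.boxSum_le hη)
  simp only [Bigraph.density_add_balanced] at hQ hR
  set p₁ := G.compXY.density
  set p₂ := G.compXZ.density
  set p₃ := G.compYZ.density
  -- The densities `dᵢ` in the definition of regularity differ from the true ones by at most `η ≤ s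
  -- ≤ pᵢ`.
  have k₁ : d₁ ≤ 2 * p₁ := by linarith [(abs_le.1 hXY.1).1]
  have k₂ : d₂ ≤ 2 * p₂ := by linarith [(abs_le.1 hXZ.1).1]
  have k₃ : d₃ ≤ 2 * p₃ := by linarith [(abs_le.1 hYZ.1).1]
  simp only [Fin.prod_univ_two, Matrix.cons_val_zero, Matrix.cons_val_one] at hO
  have ind (P : Prop) [Decidable P] :
      0 ≤ (if P then (1 : ℝ) else 0) ∧ (if P then (1 : ℝ) else 0) ≤ 1 := by
    split_ifs <;> simp
  have key := octahedron_inequalities (X := G.X) (Y := G.Y) (Z := G.Z) (h := H.balanced G)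
    (fun x z => ind ((x, z) ∈ G.compXZ.E)) (fun y z => ind ((y, z) ∈ G.compYZ.E)) hb
    (fun x y z => ?_) (fun x y z => ?_) ha hQ hR hO
  · have hp₁ : 0 ≤ p₁ := hs.trans h1
    have hp₂ : 0 ≤ p₂ := hs.trans h2
    have hp₃ : 0 ≤ p₃ := hs.trans h3
    refine le_of_pow_le_pow_left₀ (n := 8) (by norm_num) (by positivity) ?_
    rw [Even.pow_abs (by decide)]
    refine key.trans ?_
    simp only [Triad.compXZ, Triad.compYZ]
    calc _ ≤ (p₁ * G.X.card * G.Y.card) ^ 4 * (4 * p₂ ^ 2 * G.X.card * (G.Z.card : ℝ) ^ 2) ^ 2 *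
          (16 * p₃ ^ 4 * (G.Y.card : ℝ) ^ 2 * (G.Z.card : ℝ) ^ 2) *
          (r ^ 8 * (2 * p₁) ^ 4 * (2 * p₃) ^ 4 * (2 * p₂) ^ 4 *
          (G.X.card : ℝ) ^ 2 * (G.Y.card : ℝ) ^ 2 * (G.Z.card : ℝ) ^ 2) := by gcongr
      -- The factor is `4² · 16 · (2⁴)³`; rounding up to `2²⁴ = 8⁸` makes the eighth root exact.
      _ = 2 ^ 20 * (r * (p₁ * p₂ * p₃) * (G.X.card * G.Y.card * G.Z.card)) ^ 8 := by ring
      _ ≤ 2 ^ 24 * (r * (p₁ * p₂ * p₃) * (G.X.card * G.Y.card * G.Z.card)) ^ 8 := by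
          gcongr <;> norm_num
      _ = _ := by ring
  · simp only [Trigraph.balanced, Triad.K3, mem_filter, Triad.compXZ]
    split_ifs <;> simp_all
  · simp only [Trigraph.balanced, Triad.K3, mem_filter, Triad.compYZ]
    split_ifs <;> simp_all

/-- The closing arithmetic of `dichotomy`: `m` counts wrong pairs, `k` the pairs of the class, and
`z'` is the size of the substantial part of `Z`. After cancelling `p₂ p₃ z`, the constant 18 is 16
from the triangle bound plus 2 from the codegree error. -/
theorem le_of_weighted_bounds {p₁ p₂ p₃ r s x y z z' M m k : ℝ} (hp₂ : 0 < p₂)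
    (hp₃ : 0 < p₃) (hM : 0 ≤ M) (hx : 0 ≤ x) (hy : 0 ≤ y) (hm : 0 ≤ m)
    (hpos : 0 < z)
    (hs : s ≤ r * (p₁ * p₂ * p₃)) (hE : p₁ * x * y = k) (hz : z ≤ M * z')
    (h : m * (p₂ * p₃ * z') ≤ 16 * r * (p₁ * p₂ * p₃) * (x * y * z) + 2 * s * x * y * z) :
    m ≤ 18 * M * r * k := by
  have hfin : m * (p₂ * p₃ * z') ≤ 18 * r * k * (p₂ * p₃ * z) := by
    calc _ ≤ _ := h
      _ ≤ 16 * r * (p₁ * p₂ * p₃) * (x * y * z) + 2 * (r * (p₁ * p₂ * p₃)) * x * y * z := by gcongr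
      _ = 18 * r * (p₁ * x * y) * (p₂ * p₃ * z) := by ring
      _ = _ := by rw [hE]
  refine le_of_mul_le_mul_right ?_ (show 0 < p₂ * p₃ * z by positivity)
  calc m * (p₂ * p₃ * z) ≤ m * (p₂ * p₃ * (M * z')) := by gcongr
    _ = M * (m * (p₂ * p₃ * z')) := by ring
    _ ≤ M * (18 * r * k * (p₂ * p₃ * z)) := by gcongr
    _ = _ := by ring

open Classical in
/-- If on a substantial part `Z'` of `Z` membership of a triangle in `H` depends only on its first
two coordinates, then in a regular triad this dependence is nearly constant. -/
theorem Trigraph.HasDev23.dichotomy {H : Trigraph α} {G : Triad α} {η r ρ s M : ℝ}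
    (hG : (H.restrict G).HasDev23 G (r ^ 8) η) (hr : 0 ≤ r) (hr1 : r ≤ 1)
    (hρ : 0 < ρ) (hs : s = r * ρ ^ 3) (hη : η ≤ s ^ 4)
    (h1 : ρ ≤ G.compXY.density) (h2 : ρ ≤ G.compXZ.density) (h3 : ρ ≤ G.compYZ.density)
    {Z' : Finset α} (hZ' : Z' ⊆ G.Z) (hM : 0 ≤ M) (hZM : (G.Z.card : ℝ) ≤ M * Z'.card)
    (e : α → α → Prop)
    (he : ∀ x y z, (x, y, z) ∈ G.K3 → z ∈ Z' → ((x, y, z) ∈ H.E ↔ e x y)) :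
    ∃ f : Bool, ((G.EXY.filter fun p => ¬ (e p.1 p.2 ↔ f = true)).card : ℝ) ≤
      18 * M * r * G.EXY.card := by
  have hρ1 : ρ ≤ 1 := h1.trans (Bigraph.density_le_one _)
  have hs0 : 0 ≤ s := by rw [hs]; positivity
  have hsρ : s ≤ ρ := by
    rw [hs]
    calc r * ρ ^ 3 ≤ 1 * ρ := by
          gcongr
          exact pow_le_of_le_one hρ.le hρ1 (by norm_num)
      _ = ρ := one_mul ρ
  set D := (H.restrict G).relDensity G with hD
  -- `f` rounds the relative density, so that the balanced value on wrong pairs is bounded away from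
  -- 0.
  obtain ⟨f, hf⟩ : ∃ f : Bool, 1 / 2 ≤ |if f = true then -D else 1 - D| := by
    rcases le_or_gt (1 / 2) D with h | h
    · exact ⟨true, by simpa using h.trans (le_abs_self D)⟩
    · exact ⟨false, by
        simp only [Bool.false_eq_true, if_false]
        exact le_trans (by linarith) (le_abs_self _)⟩
  refine ⟨f, ?_⟩
  set c := if f = true then -D else 1 - D with hc
  set bad := G.EXY.filter fun p => ¬ (e p.1 p.2 ↔ f = true) with hbad
  set a : α → α → ℝ := fun x y => if (x, y) ∈ bad then 1 else 0 with ha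
  set b : α → ℝ := fun z => if z ∈ Z' then 1 else 0 with hb
  have suma : ∑ x ∈ G.X, ∑ y ∈ G.Y, a x y = bad.card := by
    rw [← sum_product', ← sum_filter, sum_const, nsmul_eq_mul, mul_one, filter_mem_eq_inter,
      inter_eq_right.2 ((filter_subset _ _).trans G.EXY_sub)]
  have sumb : ∑ z ∈ G.Z, b z = Z'.card := by
    rw [hb, ← sum_filter, sum_const, nsmul_eq_mul, mul_one, filter_mem_eq_inter,
      inter_eq_right.2 hZ']
  have hE : G.compXY.density * G.X.card * G.Y.card = G.EXY.card := G.compXY.density_mul_card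
  have hw := hG.abs_weighted_sum_le hr hs0 hη (hsρ.trans h1) (hsρ.trans h2) (hsρ.trans h3)
    (a := a) (b := b) (by
      rw [hE]
      calc _ = ∑ x ∈ G.X, ∑ y ∈ G.Y, a x y :=
            sum_congr rfl fun x _ => sum_congr rfl fun y _ => by simp [ha]
        _ ≤ _ := by
            rw [suma]
            exact_mod_cast card_le_card (filter_subset _ _))
    (fun z => by simp only [hb]; split_ifs <;> simp)
  obtain ⟨-, d₁, d₃, d₂, hd₁, hd₃, hd₂, hXY, hXZ, hYZ, -⟩ := hG
  have hcod := sum_abs_codegree_sub_le (b := b) hs0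
    ⟨G.compXZ.density_nonneg, G.compXZ.density_le_one⟩
    (fun y z => by rw [G.compYZ.density_add_balanced]; split_ifs <;> simp)
    (fun z => by simp only [hb]; split_ifs <;> simp)
    (hXZ.boxSum_le hη) (hYZ.boxSum_le hη)
  simp only [Bigraph.density_add_balanced] at hcod
  change ∑ x ∈ G.X, ∑ y ∈ G.Y, |∑ z ∈ G.Z, b z * ((if (x, z) ∈ G.EXZ then 1 else 0) *
    (if (y, z) ∈ G.EYZ then 1 else 0)) - _ * _ * ∑ z ∈ G.Z, b z| ≤
    2 * s * G.X.card * G.Y.card * G.Z.card at hcod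
  rw [sumb] at hcod
  set p₁ := G.compXY.density
  set p₂ := G.compXZ.density
  set p₃ := G.compYZ.density
  set cod : α → α → ℝ := fun x y => ∑ z ∈ G.Z, b z * ((if (x, z) ∈ G.EXZ then 1 else 0) *
    (if (y, z) ∈ G.EYZ then 1 else 0)) with hcoddef
  have hcod0 (x y : α) : 0 ≤ cod x y := by
    refine sum_nonneg fun z _ => ?_
    simp only [hb]; split_ifs <;> simp
  have ha0 (x y : α) : 0 ≤ a x y ∧ a x y ≤ 1 := by
    simp only [ha]; split_ifs <;> simp
  -- A wrong pair is an edge of the triad, so each common neighbour in `Z'` completes a triangle,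
  -- where the balanced function equals `c`; other `z ∈ Z'` contribute 0 to both sides.
  have hS : ∑ x ∈ G.X, ∑ y ∈ G.Y, a x y * ∑ z ∈ G.Z, b z * (H.restrict G).balanced G x y z =
      c * ∑ x ∈ G.X, ∑ y ∈ G.Y, a x y * cod x y := by
    simp only [mul_sum, hcoddef]
    refine sum_congr rfl fun x hx => sum_congr rfl fun y hy => sum_congr rfl fun z hz => ?_
    by_cases hxy : (x, y) ∈ bad
    · by_cases hzZ : z ∈ Z'
      · obtain ⟨hxyE, hxyf⟩ := mem_filter.1 hxy
        by_cases hK : (x, y, z) ∈ G.K3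
        · have hK' := hK
          simp only [Triad.K3, mem_filter] at hK'
          have hmem : (x, y, z) ∈ (H.restrict G).E ↔ ¬ f = true := by
            have : (x, y, z) ∈ (H.restrict G).E ↔ e x y := by
              simp only [Trigraph.restrict, mem_inter, hK, and_true, he x y z hK hzZ]
            rw [this]
            dsimp only at hxyf
            tauto
          have : (H.restrict G).balanced G x y z = c := by
            simp only [Trigraph.balanced, hK, if_true, ← hD, hmem, hc, ite_not]
          rw [this, if_pos hK'.2.2.2, if_pos hK'.2.2.1]; ring
        · have : ¬ ((x, z) ∈ G.EXZ ∧ (y, z) ∈ G.EYZ) := fun h => hK (by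
            simp only [Triad.K3, mem_filter, mem_product]
            exact ⟨⟨hx, hy, hz⟩, hxyE, h.2, h.1⟩)
          simp only [Trigraph.balanced, hK, if_false]
          split_ifs <;> simp_all
      · simp [hb, hzZ]
    · simp [ha, hxy]
  rw [hS, abs_mul, abs_of_nonneg (sum_nonneg fun x _ => sum_nonneg fun y _ =>
    mul_nonneg (ha0 x y).1 (hcod0 x y))] at hw
  set T := ∑ x ∈ G.X, ∑ y ∈ G.Y, a x y * cod x y with hT
  have hT0 : 0 ≤ T := sum_nonneg fun x _ => sum_nonneg fun y _ =>
    mul_nonneg (ha0 x y).1 (hcod0 x y)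
  have hT2 : T ≤ 16 * r * (p₁ * p₂ * p₃) * (G.X.card * G.Y.card * G.Z.card) := by
    nlinarith
  have hlow : bad.card * (p₂ * p₃ * Z'.card) ≤ T + 2 * s * G.X.card * G.Y.card * G.Z.card := by
    calc bad.card * (p₂ * p₃ * Z'.card)
        = ∑ x ∈ G.X, ∑ y ∈ G.Y, a x y * (p₂ * p₃ * Z'.card) := by
          simp only [← sum_mul, suma]
      _ ≤ ∑ x ∈ G.X, ∑ y ∈ G.Y, (a x y * cod x y + |cod x y - p₂ * p₃ * Z'.card|) := by
          refine sum_le_sum fun x _ => sum_le_sum fun y _ => ?_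
          have := ha0 x y
          have h4 := neg_abs_le (cod x y - p₂ * p₃ * Z'.card)
          have h5 := abs_nonneg (cod x y - p₂ * p₃ * Z'.card)
          nlinarith
      _ ≤ _ := by
          simp only [sum_add_distrib]
          exact add_le_add le_rfl hcod
  have hp₁ : 0 < p₁ := hρ.trans_le h1
  have hp₂ : 0 < p₂ := hρ.trans_le h2
  have hp₃ : 0 < p₃ := hρ.trans_le h3
  refine le_of_weighted_bounds hp₂ hp₃ hM (Nat.cast_nonneg G.X.card) (Nat.cast_nonneg G.Y.card)
    (Nat.cast_nonneg _) ?_ (s := s) ?_ hE hZM (hlow.trans ?_)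
  · rcases G.Z.eq_empty_or_nonempty with h0 | h0
    · refine absurd ?_ hp₂.ne'
      change (_ : ℝ) / (_ * (G.Z.card : ℝ)) = 0
      simp [h0]
    · exact_mod_cast h0.card_pos
  -- The reason for `s = r ρ³`: the codegree error becomes at most a multiple of `r p₁ p₂ p₃`, as
  -- for the main bound.
  · rw [hs, show ρ ^ 3 = ρ * ρ * ρ by ring]
    gcongr
  · exact add_le_add hT2 le_rfl

end Dichotomy

/-! ### Averaging over a decomposition -/

theorem sum_card_filter_le_card {ι σ : Type*} (K : Finset ι) (S : Finset σ) (p : ι → σ → Prop)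
    [∀ k, DecidablePred (p k)] (h : ∀ x ∈ S, ∀ k ∈ K, ∀ k' ∈ K, p k x → p k' x → k = k') :
    ∑ k ∈ K, (S.filter (p k)).card ≤ S.card := by
  classical
  rw [← card_biUnion]
  · exact card_le_card (biUnion_subset.2 fun k _ => filter_subset _ _)
  · intro k hk k' hk' hne
    rw [Function.onFun, disjoint_left]
    intro x hx hx'
    exact hne (h x (mem_filter.1 hx).1 k hk k' hk' (mem_filter.1 hx).2 (mem_filter.1 hx').2)

namespace Decomposition

variable {α : Type*} [DecidableEq α] {V : Finset α} {t l : ℕ}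

theorem part_unique (Q : Decomposition V t l) {i j : Fin t} {x : α} (hi : x ∈ Q.part i)
    (hj : x ∈ Q.part j) : i = j := by
  by_contra h
  exact disjoint_left.1 (Q.part_disjoint i j h) hi hj

theorem class_unique (Q : Decomposition V t l) {i j : Fin t} {a b : Fin l} {p : α × α}
    (ha : p ∈ Q.P i j a) (hb : p ∈ Q.P i j b) : a = b := by
  by_contra h
  exact disjoint_left.1 (Q.P_disjoint i j a b h) ha hb

theorem exists_part (Q : Decomposition V t l) {x : α} (hx : x ∈ V) : ∃ i, x ∈ Q.part i := by
  rw [← Q.part_cover] at hx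
  simpa using hx

theorem part_subset (Q : Decomposition V t l) (i : Fin t) : Q.part i ⊆ V := by
  intro x hx
  rw [← Q.part_cover]
  exact mem_biUnion.2 ⟨i, mem_univ _, hx⟩

/-- The parts contained in a set which is a union of parts have total size the size of the set. -/
theorem sum_card_part (Q : Decomposition V t l) {A : Finset α} (hA : A ⊆ V)
    (h : ∀ i x, x ∈ Q.part i → x ∈ A → Q.part i ⊆ A) :
    ∑ i with Q.part i ⊆ A, (Q.part i).card = A.card := by
  rw [← card_biUnion fun i _ j _ hij => Q.part_disjoint i j hij]
  congr 1
  ext x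
  simp only [mem_biUnion, mem_filter, mem_univ, true_and]
  constructor
  · rintro ⟨i, hi, hx⟩
    exact hi hx
  · intro hx
    obtain ⟨i, hi⟩ := Q.exists_part (hA hx)
    exact ⟨i, h i x hi hx, hi⟩

theorem sum_card_class (Q : Decomposition V t l) (i j : Fin t) :
    ∑ a, (Q.P i j a).card = (Q.part i).card * (Q.part j).card := by
  rw [← card_biUnion fun a _ b _ hab => Q.P_disjoint i j a b hab, Q.P_cover, card_product]

/-- The parts in `A` that are not too small cover most of `A`. -/
theorem le_sum_card_big_part (Q : Decomposition V t l) {A : Finset α} (hA : A ⊆ V)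
    (h : ∀ i x, x ∈ Q.part i → x ∈ A → Q.part i ⊆ A) {δ : ℝ} (hδ : 0 ≤ δ) :
    (1 - δ) * A.card ≤
      ∑ i with Q.part i ⊆ A ∧ δ * A.card / t ≤ (Q.part i).card, ((Q.part i).card : ℝ) := by
  have h1 : ∑ i with Q.part i ⊆ A, ((Q.part i).card : ℝ) = A.card := by
    exact_mod_cast Q.sum_card_part hA h
  rw [← sum_filter_add_sum_filter_not _ (fun i => δ * A.card / t ≤ ((Q.part i).card : ℝ)),
    filter_filter] at h1
  have h2 : ∑ i ∈ (univ.filter fun i => Q.part i ⊆ A) with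
      ¬ δ * A.card / t ≤ ((Q.part i).card : ℝ), ((Q.part i).card : ℝ) ≤ δ * A.card := by
    have ht : (0 : ℝ) < t := by exact_mod_cast Q.t_pos
    calc _ ≤ ∑ i ∈ (univ.filter fun i => Q.part i ⊆ A) with
          ¬ δ * A.card / t ≤ ((Q.part i).card : ℝ), δ * A.card / t :=
          sum_le_sum fun i hi => (not_le.1 (mem_filter.1 hi).2).le
      _ ≤ ∑ i : Fin t, δ * A.card / t :=
          sum_le_sum_of_subset_of_nonneg (subset_univ _) fun _ _ _ => by positivity
      _ = _ := by
          rw [sum_const, card_univ, Fintype.card_fin, nsmul_eq_mul]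
          field_simp
  linarith

/-- There is a pair of large parts containing few of a sparse set of triples. -/
theorem exists_big_parts (Q : Decomposition V t l) {A B : Finset α} (hA : A ⊆ V) (hB : B ⊆ V)
    (hQA : ∀ i x, x ∈ Q.part i → x ∈ A → Q.part i ⊆ A)
    (hQB : ∀ i x, x ∈ Q.part i → x ∈ B → Q.part i ⊆ B)
    {n : ℕ} (hn : 0 < n) (hAn : A.card = n) (hBn : B.card = n) {δ : ℝ} (hδ : 0 < δ)
    (hδ1 : δ < 1 / 4) {bad : Finset (α × α × α)} (hbad : (bad.card : ℝ) ≤ 27 * δ * n ^ 3) :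
    ∃ i j, Q.part i ⊆ A ∧ Q.part j ⊆ B ∧ δ * A.card / t ≤ (Q.part i).card ∧
      δ * B.card / t ≤ (Q.part j).card ∧
      ((bad.filter fun p => p.1 ∈ Q.part i ∧ p.2.1 ∈ Q.part j).card : ℝ) ≤
        54 * δ * n * ((Q.part i).card * (Q.part j).card) := by
  have hA1 := Q.le_sum_card_big_part hA hQA hδ.le
  have hB1 := Q.le_sum_card_big_part hB hQB hδ.le
  set I := univ.filter fun i => Q.part i ⊆ A ∧ δ * A.card / t ≤ ((Q.part i).card : ℝ) with hI
  set J := univ.filter fun i => Q.part i ⊆ B ∧ δ * B.card / t ≤ ((Q.part i).card : ℝ) with hJ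
  have hn' : (0 : ℝ) < n := by exact_mod_cast hn
  rw [hAn] at hA1
  rw [hBn] at hB1
  have h1 : ∑ p ∈ I ×ˢ J,
      ((bad.filter fun q => q.1 ∈ Q.part p.1 ∧ q.2.1 ∈ Q.part p.2).card : ℝ) ≤ 27 * δ * n ^ 3 := by
    refine le_trans ?_ hbad
    have := sum_card_filter_le_card (I ×ˢ J) bad
      (fun p q => q.1 ∈ Q.part p.1 ∧ q.2.1 ∈ Q.part p.2)
      (fun x _ k _ k' _ hk hk' =>
        Prod.ext (Q.part_unique hk.1 hk'.1) (Q.part_unique hk.2 hk'.2))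
    exact_mod_cast this
  have h2 : 27 * δ * n ^ 3 <
      -- Large parts cover at least `(1 - δ)² > 1/2` of `A × B`, whence the doubling from 27 to 54.
      ∑ p ∈ I ×ˢ J, 54 * δ * n * (((Q.part p.1).card : ℝ) * (Q.part p.2).card) := by
    rw [← mul_sum, sum_product]
    dsimp only
    rw [← sum_mul_sum]
    have h3 : ((1 - δ) * n) * ((1 - δ) * n) ≤
        (∑ i ∈ I, ((Q.part i).card : ℝ)) * ∑ j ∈ J, ((Q.part j).card : ℝ) :=
      mul_le_mul hA1 hB1 (mul_nonneg (by linarith) hn'.le) (sum_nonneg fun _ _ => by positivity)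
    calc 27 * δ * (n : ℝ) ^ 3 = 54 * δ * n * (1 / 2 * n ^ 2) := by ring
      _ < 54 * δ * n * ((1 - δ) * (1 - δ) * n ^ 2) := by
          have : 1 / 2 < (1 - δ) * (1 - δ) := by nlinarith
          gcongr
      _ = 54 * δ * n * (((1 - δ) * n) * ((1 - δ) * n)) := by ring
      _ ≤ _ := by gcongr
  obtain ⟨p, hp, hlt⟩ := exists_lt_of_sum_lt (h1.trans_lt h2)
  obtain ⟨hpI, hpJ⟩ := mem_product.1 hp
  obtain ⟨-, hi1, hi2⟩ := mem_filter.1 hpI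
  obtain ⟨-, hj1, hj2⟩ := mem_filter.1 hpJ
  exact ⟨p.1, p.2, hi1, hj1, hi2, hj2, hlt.le⟩

/-- The classes that are neither small nor rich in triples of a sparse set cover most pairs. -/
theorem le_card_biUnion_good_classes (Q : Decomposition V t l) (i j : Fin t)
    {n : ℕ} (hn : 0 < n) {δ θ κ : ℝ} (hθ : 0 ≤ θ) (hκ : 0 < κ) (hδ : 54 * δ ≤ θ * κ)
    {bad : Finset (α × α × α)}
    (hbad : ((bad.filter fun p => p.1 ∈ Q.part i ∧ p.2.1 ∈ Q.part j).card : ℝ) ≤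
        54 * δ * n * ((Q.part i).card * (Q.part j).card)) :
    (1 - 2 * θ) * (Q.part i).card * (Q.part j).card ≤
      (((univ.filter fun a : Fin l =>
        θ * ((Q.part i).card * (Q.part j).card) / l ≤ (Q.P i j a).card ∧
        ((bad.filter fun p => (p.1, p.2.1) ∈ Q.P i j a).card : ℝ) ≤
          κ * (Q.P i j a).card * n).biUnion (Q.P i j)).card : ℝ) := by
  set m : ℝ := (Q.part i).card * (Q.part j).card with hm
  have hm0 : 0 ≤ m := by positivity
  have hl : (0 : ℝ) < l := by exact_mod_cast Q.l_pos
  have hn' : (0 : ℝ) < n := by exact_mod_cast hn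
  set Z := univ.filter fun a : Fin l => θ * m / l ≤ (Q.P i j a).card ∧
        ((bad.filter fun p => (p.1, p.2.1) ∈ Q.P i j a).card : ℝ) ≤
          κ * (Q.P i j a).card * n with hZ
  rw [card_biUnion fun a _ b _ hab => Q.P_disjoint i j a b hab]
  have h1 : ∑ a, ((Q.P i j a).card : ℝ) = m := by
    rw [hm]; exact_mod_cast Q.sum_card_class i j
  rw [← sum_filter_add_sum_filter_not _ (fun a => a ∈ Z), filter_mem_eq_inter, univ_inter] at h1
  have hb : ∑ a, ((bad.filter fun p => (p.1, p.2.1) ∈ Q.P i j a).card : ℝ) ≤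
      54 * δ * n * m := by
    refine le_trans ?_ hbad
    have h := sum_card_filter_le_card univ
      (bad.filter fun p => p.1 ∈ Q.part i ∧ p.2.1 ∈ Q.part j)
      (fun a p => (p.1, p.2.1) ∈ Q.P i j a) (fun x _ k _ k' _ hk hk' => Q.class_unique hk hk')
    have e (a : Fin l) : ((bad.filter fun p => p.1 ∈ Q.part i ∧ p.2.1 ∈ Q.part j).filter
        fun p => (p.1, p.2.1) ∈ Q.P i j a) = bad.filter fun p => (p.1, p.2.1) ∈ Q.P i j a := by
      rw [filter_filter]
      refine filter_congr fun p _ => ⟨fun h => h.2, fun h => ⟨?_, h⟩⟩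
      exact mem_product.1 (Q.P_sub i j a h)
    simp only [e] at h
    exact_mod_cast h
  have hκn : 0 < κ * n := mul_pos hκ hn'
  have hlm : l * (θ * m / l) = θ * m := by field_simp
  have hθml : 0 ≤ θ * m / l := by positivity
  have hZ' (a : Fin l) (ha : a ∉ Z) : ((Q.P i j a).card : ℝ) < θ * m / l ∨
      κ * (Q.P i j a).card * n < (bad.filter fun p => (p.1, p.2.1) ∈ Q.P i j a).card := by
    rw [hZ, mem_filter, not_and_or, not_and_or] at ha
    rcases ha with h | h | h
    · exact absurd (mem_univ a) h
    · exact Or.inl (not_le.1 h)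
    · exact Or.inr (not_le.1 h)
  obtain ⟨f, hf⟩ : ∃ f : Fin l → ℝ,
      f = fun a => ((bad.filter fun p => (p.1, p.2.1) ∈ Q.P i j a).card : ℝ) := ⟨_, rfl⟩
  have hf0 (a : Fin l) : 0 ≤ f a / (κ * n) := by
    rw [hf]; exact div_nonneg (Nat.cast_nonneg _) hκn.le
  have hbf : ∑ a, f a ≤ 54 * δ * n * m := by rw [hf]; exact hb
  -- A discarded class is small or rich in bad triples, so one of the two nonnegative terms bounds
  -- its size. Each term sums to at most `θ m`.
  have h2 : ∑ a with a ∉ Z, ((Q.P i j a).card : ℝ) ≤ θ * m + θ * m := by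
    calc _ ≤ ∑ a with a ∉ Z, (θ * m / l + f a / (κ * n)) := by
          refine sum_le_sum fun a ha => ?_
          rcases hZ' a (mem_filter.1 ha).2 with h | h
          · linarith [hf0 a]
          · have h4 : ((Q.P i j a).card : ℝ) ≤ f a / (κ * n) := by
              rw [le_div_iff₀ hκn, hf]
              linarith
            linarith
      _ ≤ ∑ a, (θ * m / l + f a / (κ * n)) :=
          sum_le_sum_of_subset_of_nonneg (subset_univ _) fun a _ _ => add_nonneg hθml (hf0 a)
      _ = θ * m + (∑ a, f a) / (κ * n) := by
          rw [sum_add_distrib, sum_const, card_univ, Fintype.card_fin, nsmul_eq_mul, ← sum_div, hlm]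
      _ ≤ θ * m + θ * m := by
          gcongr
          rw [div_le_iff₀ hκn]
          calc _ ≤ _ := hbf
            _ = 54 * δ * (n * m) := by ring
            _ ≤ θ * κ * (n * m) := by gcongr
            _ = _ := by ring
  push_cast
  calc _ = m - (θ * m + θ * m) := by rw [hm]; ring
    _ ≤ _ := by linarith

open Classical in
/-- Few pairs between a part and a union of parts lie in a class of small density. -/
theorem card_sparse_pairs_le (Q : Decomposition V t l) (i : Fin t) (K : Finset (Fin t)) {ρ : ℝ}
    (hρ : 0 ≤ ρ) :
    ((K.biUnion fun k => (univ.filter fun b : Fin l =>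
      ((Q.P i k b).card : ℝ) < ρ * ((Q.part i).card * (Q.part k).card)).biUnion
        (Q.P i k)).card : ℝ) ≤
      l * ρ * (Q.part i).card * ∑ k ∈ K, ((Q.part k).card : ℝ) := by
  calc _ ≤ ∑ k ∈ K, ∑ b with ((Q.P i k b).card : ℝ) < ρ * ((Q.part i).card * (Q.part k).card),
        ((Q.P i k b).card : ℝ) := by
        have : _ ≤ ∑ k ∈ K, ∑ b with ((Q.P i k b).card : ℝ) <
          ρ * ((Q.part i).card * (Q.part k).card), (Q.P i k b).card :=
          card_biUnion_le.trans (sum_le_sum fun k _ => card_biUnion_le)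
        exact_mod_cast this
    _ ≤ ∑ k ∈ K, ∑ b : Fin l, ρ * ((Q.part i).card * (Q.part k).card) := by
        refine sum_le_sum fun k _ => ?_
        calc _ ≤ ∑ b with ((Q.P i k b).card : ℝ) < ρ * ((Q.part i).card * (Q.part k).card),
              ρ * ((Q.part i).card * (Q.part k).card) :=
              sum_le_sum fun b hb => (mem_filter.1 hb).2.le
          _ ≤ _ := sum_le_sum_of_subset_of_nonneg (subset_univ _) fun _ _ _ => by positivity
    _ = _ := by
        simp only [sum_const, card_univ, Fintype.card_fin, nsmul_eq_mul, mul_sum]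
        exact sum_congr rfl fun k _ => by ring

/-- A triple over a given class and a given subset of the third vertex class that avoids a sparse
set, lies in a part where the subset is dense, and lies over classes of substantial density. -/
theorem exists_typical_triple (Q : Decomposition V t l) (i j : Fin t) (a : Fin l)
    {C D : Finset α} (hC : C ⊆ V) (hQC : ∀ i x, x ∈ Q.part i → x ∈ C → Q.part i ⊆ C)
    (hDC : D ⊆ C) {N : ℕ} (hN : 0 < N) (hD : 0 < D.card) (hCD : C.card = N * D.card)
    {θ ρ κ : ℝ} (hθ : 0 < θ) (hρ : 0 ≤ ρ) (hρθ : ρ * (16 * l ^ 2 * N) ≤ θ) (hκN : κ * N ≤ 1 / 8)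
    {bad : Finset (α × α × α)}
    (hi : 0 < (Q.part i).card) (hj : 0 < (Q.part j).card)
    (hsize : θ * ((Q.part i).card * (Q.part j).card) / l ≤ (Q.P i j a).card)
    (hbad : ((bad.filter fun p => (p.1, p.2.1) ∈ Q.P i j a).card : ℝ) ≤
      κ * (Q.P i j a).card * C.card) :
    ∃ x y z, (x, y) ∈ Q.P i j a ∧ z ∈ D ∧ (x, y, z) ∉ bad ∧
      (∀ k, z ∈ Q.part k → ((Q.part k).card : ℝ) ≤ 4 * N * (Q.part k ∩ D).card) ∧
      (∀ k b, (x, z) ∈ Q.P i k b →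
        ρ * ((Q.part i).card * (Q.part k).card) ≤ (Q.P i k b).card) ∧
      (∀ k c, (y, z) ∈ Q.P j k c →
        ρ * ((Q.part j).card * (Q.part k).card) ≤ (Q.P j k c).card) := by
  classical
  have hl : (0 : ℝ) < l := by exact_mod_cast Q.l_pos
  have hN' : (0 : ℝ) < N := by exact_mod_cast hN
  have hD' : (0 : ℝ) < D.card := by exact_mod_cast hD
  have hCD' : (C.card : ℝ) = N * D.card := by exact_mod_cast hCD
  have hi' : (0 : ℝ) < (Q.part i).card := by exact_mod_cast hi
  have hj' : (0 : ℝ) < (Q.part j).card := by exact_mod_cast hj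
  set P := Q.P i j a with hP
  have hP0 : (0 : ℝ) < P.card := lt_of_lt_of_le (by positivity) hsize
  set K := univ.filter fun k => Q.part k ⊆ C with hK
  have hKsum : ∑ k ∈ K, ((Q.part k).card : ℝ) = C.card := by
    exact_mod_cast Q.sum_card_part hC hQC
  -- Otherwise `P × D` is covered by four exceptional sets: bad triples (`S₀`), `z` in a part where
  -- `D` is thin (`S₁`), and `xz` or `yz` in a sparse class (`S₂`, `S₃`). Their shares are at most
  -- 1/8, 1/4, 1/16 and 1/16, which sum to 1/2.
  by_contra! hcon
  set L₁ := K.biUnion fun k => (univ.filter fun b : Fin l =>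
      ((Q.P i k b).card : ℝ) < ρ * ((Q.part i).card * (Q.part k).card)).biUnion (Q.P i k) with hL₁
  set L₂ := K.biUnion fun k => (univ.filter fun b : Fin l =>
      ((Q.P j k b).card : ℝ) < ρ * ((Q.part j).card * (Q.part k).card)).biUnion (Q.P j k) with hL₂
  set E := (K.filter fun k => 4 * (N : ℝ) * (Q.part k ∩ D).card < (Q.part k).card).biUnion
    (fun k => Q.part k ∩ D) with hE
  set S₀ := (bad.filter fun p => (p.1, p.2.1) ∈ P).image fun p => ((p.1, p.2.1), p.2.2) with hS₀
  set S₁ := P ×ˢ E with hS₁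
  set S₂ := (L₁ ×ˢ Q.part j).image fun p => ((p.1.1, p.2), p.1.2) with hS₂
  set S₃ := (L₂ ×ˢ Q.part i).image fun p => ((p.2, p.1.1), p.1.2) with hS₃
  have hL₁c := Q.card_sparse_pairs_le i K hρ
  have hL₂c := Q.card_sparse_pairs_le j K hρ
  rw [← hL₁, hKsum] at hL₁c
  rw [← hL₂, hKsum] at hL₂c
  have hEc : (E.card : ℝ) ≤ D.card / 4 := by
    have h4N : (0 : ℝ) < 4 * N := by positivity
    calc (E.card : ℝ) ≤ ∑ k ∈ K with 4 * (N : ℝ) * (Q.part k ∩ D).card < (Q.part k).card,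
          ((Q.part k ∩ D).card : ℝ) := by
          rw [hE]; exact_mod_cast card_biUnion_le
      _ ≤ ∑ k ∈ K with 4 * (N : ℝ) * (Q.part k ∩ D).card < (Q.part k).card,
          ((Q.part k).card : ℝ) / (4 * N) := by
          refine sum_le_sum fun k hk => ?_
          rw [le_div_iff₀ h4N]
          linarith [(mem_filter.1 hk).2]
      _ ≤ ∑ k ∈ K, ((Q.part k).card : ℝ) / (4 * N) :=
          sum_le_sum_of_subset_of_nonneg (filter_subset _ _) fun _ _ _ => by positivity
      _ = D.card / 4 := by
          rw [← sum_div, hKsum, hCD']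
          field_simp
  have hcover : P ×ˢ D ⊆ S₀ ∪ S₁ ∪ S₂ ∪ S₃ := by
    rintro ⟨⟨x, y⟩, z⟩ hp
    obtain ⟨hxy, hz⟩ := mem_product.1 hp
    dsimp only at hxy hz
    obtain ⟨hxi, hyj⟩ := mem_product.1 (Q.P_sub i j a hxy)
    have hzK (k : Fin t) (hk : z ∈ Q.part k) : k ∈ K :=
      mem_filter.2 ⟨mem_univ _, hQC k z hk (hDC hz)⟩
    simp only [mem_union]
    by_cases h0 : (x, y, z) ∈ bad
    · exact Or.inl (Or.inl (Or.inl (mem_image.2 ⟨(x, y, z), mem_filter.2 ⟨h0, hxy⟩, rfl⟩)))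
    by_cases h1 : ∀ k, z ∈ Q.part k → ((Q.part k).card : ℝ) ≤ 4 * N * (Q.part k ∩ D).card
    · by_cases h2 : ∀ k b, (x, z) ∈ Q.P i k b →
        ρ * ((Q.part i).card * (Q.part k).card) ≤ (Q.P i k b).card
      · obtain ⟨k, c, h3, h4⟩ := hcon x y z hxy hz h0 h1 h2
        refine Or.inr (mem_image.2 ⟨((y, z), x), mem_product.2 ⟨?_, hxi⟩, rfl⟩)
        exact mem_biUnion.2 ⟨k, hzK k (mem_product.1 (Q.P_sub j k c h3)).2,
          mem_biUnion.2 ⟨c, mem_filter.2 ⟨mem_univ _, h4⟩, h3⟩⟩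
      · push Not at h2
        obtain ⟨k, b, h3, h4⟩ := h2
        refine Or.inl (Or.inr (mem_image.2 ⟨((x, z), y), mem_product.2 ⟨?_, hyj⟩, rfl⟩))
        exact mem_biUnion.2 ⟨k, hzK k (mem_product.1 (Q.P_sub i k b h3)).2,
          mem_biUnion.2 ⟨b, mem_filter.2 ⟨mem_univ _, h4⟩, h3⟩⟩
    · push Not at h1
      obtain ⟨k, hk, h3⟩ := h1
      refine Or.inl (Or.inl (Or.inr (mem_product.2 ⟨hxy, ?_⟩)))
      exact mem_biUnion.2 ⟨k, mem_filter.2 ⟨hzK k hk, h3⟩, mem_inter.2 ⟨hk, hz⟩⟩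
  have hcard : (P.card : ℝ) * D.card ≤ S₀.card + S₁.card + S₂.card + S₃.card := by
    have h := (card_le_card hcover).trans ((card_union_le _ _).trans
      (add_le_add_left ((card_union_le _ _).trans (add_le_add_left (card_union_le _ _) _)) _))
    rw [card_product] at h
    exact_mod_cast h
  have c0 : (S₀.card : ℝ) ≤ 1 / 8 * (P.card * D.card) := by
    calc (S₀.card : ℝ) ≤ _ := by rw [hS₀]; exact_mod_cast card_image_le
      _ ≤ _ := hbad
      _ = κ * N * (P.card * D.card) := by rw [hCD']; ring
      _ ≤ _ := by gcongr
  have c1 : (S₁.card : ℝ) ≤ 1 / 4 * (P.card * D.card) := by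
    rw [hS₁, card_product]
    push_cast
    calc (P.card : ℝ) * E.card ≤ P.card * (D.card / 4) := by gcongr
      _ = _ := by ring
  -- Here `ρ` must beat `θ / (16 l² N)`: one factor `l` comes from the number of sparse classes, one
  -- from the lower bound on `|P|`, and `N` from `|C| = N |D|`.
  have hsparse : l * ρ * ((Q.part i).card * (Q.part j).card) * C.card ≤
      1 / 16 * (P.card * D.card) := by
    have h1 : θ * ((Q.part i).card * (Q.part j).card) ≤ P.card * l := (div_le_iff₀ hl).1 hsize
    refine le_of_mul_le_mul_left ?_ (show 0 < 16 * (l : ℝ) by positivity)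
    calc _ = ρ * (16 * l ^ 2 * N) * ((Q.part i).card * (Q.part j).card) * D.card := by
          rw [hCD']; ring
      _ ≤ θ * ((Q.part i).card * (Q.part j).card) * D.card := by gcongr
      _ ≤ P.card * l * D.card := by gcongr
      _ = _ := by ring
  have c2 : (S₂.card : ℝ) ≤ 1 / 16 * (P.card * D.card) := by
    calc (S₂.card : ℝ) ≤ L₁.card * (Q.part j).card := by
          rw [hS₂, ← Nat.cast_mul, ← card_product]; exact_mod_cast card_image_le
      _ ≤ (l * ρ * (Q.part i).card * C.card) * (Q.part j).card := by gcongr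
      _ = l * ρ * ((Q.part i).card * (Q.part j).card) * C.card := by ring
      _ ≤ _ := hsparse
  have c3 : (S₃.card : ℝ) ≤ 1 / 16 * (P.card * D.card) := by
    calc (S₃.card : ℝ) ≤ L₂.card * (Q.part i).card := by
          rw [hS₃, ← Nat.cast_mul, ← card_product]; exact_mod_cast card_image_le
      _ ≤ (l * ρ * (Q.part j).card * C.card) * (Q.part i).card := by gcongr
      _ = l * ρ * ((Q.part i).card * (Q.part j).card) * C.card := by ring
      _ ≤ _ := hsparse
  have : (0 : ℝ) < P.card * D.card := mul_pos hP0 hD'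
  linarith

end Decomposition

/-! ### Blowups: colours and edges -/

theorem Triad.mem_K3 {α : Type*} [DecidableEq α] {G : Triad α} {x y z : α} :
    (x, y, z) ∈ G.K3 ↔ (x ∈ G.X ∧ y ∈ G.Y ∧ z ∈ G.Z) ∧
      (x, y) ∈ G.EXY ∧ (y, z) ∈ G.EYZ ∧ (x, z) ∈ G.EXZ := by
  simp only [Triad.K3, mem_filter, mem_product]

section Blowup

variable {α υ ν : Type*} [DecidableEq α]
  {G : Bigraph υ ν} {Γ : ColoredGraph α G.left} {m : ℕ} {C : ν → Finset α} {H : ThreeGraph α}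

/-- Every pair between `A` and `B` has a colour. -/
theorem ColoredGraph.exists_colour (Γ : ColoredGraph α G.left) {x y : α} (hx : x ∈ Γ.A)
    (hy : y ∈ Γ.B) : ∃ u ∈ G.left, ({x, y} : Finset α) ∈ Γ.P u := by
  have h : ({x, y} : Finset α) ∈ K2 Γ.A Γ.B := by
    refine mem_image.2 ⟨(x, y), mem_filter.2 ⟨mem_product.2 ⟨hx, hy⟩, ?_⟩, rfl⟩
    intro (h : x = y)
    exact disjoint_left.1 Γ.A_disjoint_B hx (h ▸ hy)
  rw [← Γ.P_cover] at h
  simpa using h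

variable [DecidableEq υ] [DecidableEq ν]

/-- For `f = false`, the pair still has some colour, and that colour is not in `N¹(v)`. -/
theorem exists_nbr_of_iff (Γ : ColoredGraph α G.left) {v : ν} {x y : α} (hx : x ∈ Γ.A)
    (hy : y ∈ Γ.B) {f : Bool}
    (h : (∃ u ∈ G.nbr true v, ({x, y} : Finset α) ∈ Γ.P u) ↔ f = true) :
    ∃ u ∈ G.nbr f v, ({x, y} : Finset α) ∈ Γ.P u := by
  cases f with
  | true => exact h.2 rfl
  | false =>
    obtain ⟨u, hu, hxy⟩ := Γ.exists_colour hx hy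
    refine ⟨u, mem_filter.2 ⟨hu, fun huv => ?_⟩, hxy⟩
    exact absurd (h.1 ⟨u, mem_filter.2 ⟨hu, huv⟩, hxy⟩) (by simp)

theorem IsBlowup.mem_bar_iff (hH : IsBlowup G Γ m C H) {v : ν} (hv : v ∈ G.right) {x y z : α}
    (hx : x ∈ Γ.A) (hy : y ∈ Γ.B) (hz : z ∈ C v) :
    (x, y, z) ∈ H.bar.E ↔ ∃ u ∈ G.nbr true v, ({x, y} : Finset α) ∈ Γ.P u := by
  have hxv : x ∈ H.verts := by rw [hH.verts_eq]; simp [hx]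
  have hyv : y ∈ H.verts := by rw [hH.verts_eq]; simp [hy]
  have hzv : z ∈ H.verts := by
    rw [hH.verts_eq]
    exact mem_union_right _ (mem_biUnion.2 ⟨v, hv, hz⟩)
  simp only [ThreeGraph.bar, mem_filter, mem_product, hxv, hyv, hzv, and_self, true_and]
  constructor
  · intro h
    obtain ⟨u, hu, hxy⟩ := Γ.exists_colour hx hy
    refine ⟨u, mem_filter.2 ⟨hu, ?_⟩, hxy⟩
    by_contra huv
    exact hH.non_edge u hu v hv huv x y z hxy hz h
  · rintro ⟨u, hu, hxy⟩
    obtain ⟨hu, huv⟩ := mem_filter.1 hu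
    exact hH.edge u hu v hv huv x y z hxy hz

theorem Bigraph.le_density_of_le {β γ : Type*} {F : Bigraph β γ} {ρ : ℝ} (h1 : 0 < F.left.card)
    (h2 : 0 < F.right.card) (h : ρ * (F.left.card * F.right.card) ≤ F.E.card) :
    ρ ≤ F.density := by
  have h1' : (0 : ℝ) < F.left.card := by exact_mod_cast h1
  have h2' : (0 : ℝ) < F.right.card := by exact_mod_cast h2
  exact (le_div_iff₀ (by positivity)).2 h

open Classical in
/-- The triples of vertices of `H` not lying over a regular triad. -/
noncomputable def irregularTriples {t l : ℕ} (H : ThreeGraph α) (Q : Decomposition H.verts t l) (ε₁ ε₂ : ℝ) :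
    Finset (α × α × α) :=
  (H.verts ×ˢ H.verts ×ˢ H.verts).filter fun p =>
      ¬ ∃ i j k a b c, p ∈ (Q.triad i j k a b c).K3 ∧
        (H.bar.restrict (Q.triad i j k a b c)).HasDev23 (Q.triad i j k a b c) ε₁ ε₂

open Classical in
/-- Over a typical class, membership of the colour in the neighbourhood of a given vertex is nearly
constant. -/
theorem IsBlowup.nearly_constant_on_class (hH : IsBlowup G Γ m C H) (hm : 0 < m)
    {t l : ℕ} (Q : Decomposition H.verts t l)
    (hQC : ∀ i x, x ∈ Q.part i → x ∈ G.right.biUnion C → Q.part i ⊆ G.right.biUnion C)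
    {i j : Fin t} (hiA : Q.part i ⊆ Γ.A) (hjB : Q.part j ⊆ Γ.B)
    (hi : 0 < (Q.part i).card) (hj : 0 < (Q.part j).card) {a : Fin l} {v : ν} (hv : v ∈ G.right)
    {θ ρ κ r η : ℝ} (hr : 0 ≤ r) (hr1 : r ≤ 1) (hη : η ≤ (r * ρ ^ 3) ^ 4) (hθ : 0 < θ)
    (hρ : 0 < ρ)
    (hρθ : ρ * (16 * l ^ 2 * G.right.card) ≤ θ) (hκ : κ * G.right.card ≤ 1 / 8)
    (hsize : θ * ((Q.part i).card * (Q.part j).card) / l ≤ (Q.P i j a).card)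
    (hbad : (((irregularTriples H Q (r ^ 8) η).filter fun p =>
      (p.1, p.2.1) ∈ Q.P i j a).card : ℝ) ≤
        κ * (Q.P i j a).card * ((G.right.card * m : ℕ) : ℝ)) :
    ∃ f : Bool, (((Q.P i j a).filter fun p =>
      ¬ ((∃ u ∈ G.nbr true v, ({p.1, p.2} : Finset α) ∈ Γ.P u) ↔ f = true)).card : ℝ) ≤
        18 * (4 * G.right.card) * r * (Q.P i j a).card := by
  have hN : 0 < G.right.card := card_pos.2 ⟨v, hv⟩
  have hl : 1 ≤ l := Q.l_pos
  have hl1 : (1 : ℝ) ≤ l := by exact_mod_cast hl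
  have hN1 : (1 : ℝ) ≤ G.right.card := by exact_mod_cast hN
  have hCsub : G.right.biUnion C ⊆ H.verts := by
    rw [hH.verts_eq]; exact subset_union_right
  have hCcard : (G.right.biUnion C).card = G.right.card * m := by
    rw [card_biUnion fun v hv w hw hvw => hH.C_disjoint v hv w hw hvw,
      sum_congr rfl fun v hv => hH.card_C v hv, sum_const, smul_eq_mul]
  obtain ⟨x, y, z, hxy, hz, hnb, hpart, hxz, hyz⟩ := Q.exists_typical_triple i j a hCsub hQC
    (subset_biUnion_of_mem C hv) hN (by rw [hH.card_C v hv]; exact hm)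
    (by rw [hCcard, hH.card_C v hv]) hθ hρ.le hρθ hκ hi hj hsize (by rw [hCcard]; exact hbad)
  obtain ⟨hxi, hyj⟩ := mem_product.1 (Q.P_sub i j a hxy)
  dsimp only at hxi hyj
  have hgood : ∃ i j k a b c, (x, y, z) ∈ (Q.triad i j k a b c).K3 ∧
      (H.bar.restrict (Q.triad i j k a b c)).HasDev23 (Q.triad i j k a b c) (r ^ 8) η := by
    by_contra hcon
    refine hnb (mem_filter.2 ⟨?_, hcon⟩)
    exact mem_product.2 ⟨Q.part_subset i hxi, mem_product.2 ⟨Q.part_subset j hyj,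
      hCsub (mem_biUnion.2 ⟨v, hv, hz⟩)⟩⟩
  obtain ⟨i', j', k, a', b, c, hK, hdev⟩ := hgood
  obtain ⟨⟨hxi', hyj', hzk⟩, hxy', hyz', hxz'⟩ := Triad.mem_K3.1 hK
  change x ∈ Q.part i' at hxi'
  change y ∈ Q.part j' at hyj'
  change z ∈ Q.part k at hzk
  change (x, y) ∈ Q.P i' j' a' at hxy'
  -- The regular triad through the typical triple comes with its own indices. Disjointness of parts
  -- and classes shows that its first bigraph is the given class.
  obtain rfl := Q.part_unique hxi hxi'
  obtain rfl := Q.part_unique hyj hyj'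
  obtain rfl := Q.class_unique hxy hxy'
  have hk : 0 < (Q.part k).card := card_pos.2 ⟨z, hzk⟩
  have hρa : ρ * ((Q.part i).card * (Q.part j).card) ≤ (Q.P i j a).card := by
    refine le_trans ?_ hsize
    rw [le_div_iff₀ (by linarith)]
    have h1 : ρ * l ≤ θ := by
      refine le_trans ?_ hρθ
      have h2 : (1 : ℝ) * l * 1 ≤ 16 * l ^ 2 * G.right.card := by
        have h3 : (l : ℝ) ≤ l ^ 2 := by nlinarith
        gcongr
        norm_num
      have := mul_le_mul_of_nonneg_left h2 hρ.le
      linarith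
    calc _ = ρ * l * ((Q.part i).card * (Q.part j).card) := by ring
      _ ≤ _ := by gcongr
  obtain ⟨f, hf⟩ := hdev.dichotomy hr hr1 hρ rfl hη (Bigraph.le_density_of_le hi hj hρa)
    (Bigraph.le_density_of_le hi hk (hxz k b hxz')) (Bigraph.le_density_of_le hj hk (hyz k c hyz'))
    (Z' := Q.part k ∩ C v) inter_subset_left (by positivity) (hpart k hzk)
    (fun x y => ∃ u ∈ G.nbr true v, ({x, y} : Finset α) ∈ Γ.P u)
    (fun x' y' z' hK' hz' => by
      obtain ⟨hx, hy, -⟩ := (Triad.mem_K3.1 hK').1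
      exact hH.mem_bar_iff hv (hiA hx) (hjB hy) (mem_inter.1 hz').2)
  refine ⟨f, ?_⟩
  convert hf <;> rfl

end Blowup

/-! ### Union bound and choice of the density threshold -/

/-- A union bound over the failure sets of a family of properties. -/
theorem sub_le_card_filter_forall {σ ν : Type*} [DecidableEq σ] (P : Finset σ) (R : Finset ν)
    (p : ν → σ → Prop) [∀ v, DecidablePred (p v)] [DecidablePred fun x => ∀ v ∈ R, p v x] {c : ℝ}
    (h : ∀ v ∈ R, ((P.filter fun x => ¬ p v x).card : ℝ) ≤ c) :
    (P.card : ℝ) - R.card * c ≤ (P.filter fun x => ∀ v ∈ R, p v x).card := by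
  have h1 : ((P.filter fun x => ¬ ∀ v ∈ R, p v x).card : ℝ) ≤ R.card * c := by
    calc _ ≤ ((R.biUnion fun v => P.filter fun x => ¬ p v x).card : ℝ) := by
          refine Nat.cast_le.2 (card_le_card fun x hx => ?_)
          obtain ⟨hxP, hx⟩ := mem_filter.1 hx
          push Not at hx
          obtain ⟨v, hv, hx⟩ := hx
          exact mem_biUnion.2 ⟨v, hv, mem_filter.2 ⟨hxP, hx⟩⟩
      _ ≤ ∑ v ∈ R, ((P.filter fun x => ¬ p v x).card : ℝ) := by exact_mod_cast card_biUnion_le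
      _ ≤ ∑ v ∈ R, c := sum_le_sum h
      _ = _ := by rw [sum_const, nsmul_eq_mul]
  have h2 : ((P.filter fun x => ∀ v ∈ R, p v x).card : ℝ) +
      (P.filter fun x => ¬ ∀ v ∈ R, p v x).card = P.card := by
    exact_mod_cast card_filter_add_card_filter_not _
  linarith

/-- The density threshold for classes of a decomposition with `l` classes per pair of parts. -/
noncomputable def densityThreshold (e : ℝ) (N l : ℕ) : ℝ := e ^ 16 / 2 / (16 * (l + 1) ^ 2 * N)

/-- The `l + 1` in the definition keeps the threshold meaningful at `l = 0`, where the bound on `ε₂`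
must still be positive. -/
theorem densityThreshold_pos {e : ℝ} (he : 0 < e) {N : ℕ} (hN : 0 < N) (l : ℕ) :
    0 < densityThreshold e N l := by
  unfold densityThreshold; positivity

theorem densityThreshold_mul_le {e : ℝ} (he : 0 < e) {N : ℕ} (hN : 0 < N) (l : ℕ) :
    densityThreshold e N l * (16 * l ^ 2 * N) ≤ e ^ 16 / 2 := by
  have hN' : (0 : ℝ) < N := by exact_mod_cast hN
  unfold densityThreshold
  rw [div_mul_eq_mul_div, div_le_iff₀ (by positivity)]
  gcongr
  linarith

theorem densityThreshold_lt_one {e : ℝ} (he : 0 < e) (he1 : e < 1) {N : ℕ} (hN : 0 < N) (l : ℕ) :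
    densityThreshold e N l < 1 := by
  have hN' : (1 : ℝ) ≤ N := by exact_mod_cast hN
  unfold densityThreshold
  rw [div_lt_one (by positivity)]
  have h1 : e ^ 16 < 1 := pow_lt_one₀ he.le he1 (by norm_num)
  have h2 : (1 : ℝ) * 1 ^ 2 * 1 ≤ 16 * (l + 1) ^ 2 * N := by
    gcongr
    · norm_num
    · linarith [(Nat.cast_nonneg l : (0 : ℝ) ≤ l)]
  linarith

end TripleReg

/-! ### Assembly and constants -/

open TripleReg

theorem mainTheorem10 :
    ∃ D εs : ℝ, 0 < D ∧ 0 < εs ∧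
    ∀ (υ ν : Type*) [DecidableEq υ] [DecidableEq ν] (G : Bigraph υ ν),
      G.left.Nonempty → G.right.Nonempty → G.Irreducible →
    ∀ ε₁ : ℝ, 0 < ε₁ → ε₁ < min ((G.right.card : ℝ) ^ (-D)) (εs ^ D) →
    ∃ ε₂s : ℕ → ℝ, (∀ x, 0 < ε₂s x ∧ ε₂s x < 1) ∧
    ∀ t : ℕ, 1 ≤ t →
    ∀ ε₂ : ℕ → ℝ, (∀ x, 0 < ε₂ x ∧ ε₂ x < 1) → (∀ x, ε₂ x < ε₂s x) →
    ∃ ε : ℝ, 0 < ε ∧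
    ∃ n₀ : ℕ, ∀ n : ℕ, n₀ ≤ n → G.right.card ∣ n →
    ∀ (α : Type*) [DecidableEq α] (Γ : ColoredGraph α G.left),
      Γ.A.card = n → Γ.B.card = n →
      (∀ u ∈ G.left, IsEpsRegular Γ.A Γ.B (Γ.P u) ε ∧
        |pairDensity (Γ.P u) Γ.A Γ.B - 1 / (G.left.card : ℝ)| ≤ ε) →
    ∀ (C : ν → Finset α) (H : ThreeGraph α), IsBlowup G Γ (n / G.right.card) C H →
    ∀ (l : ℕ) (Q : Decomposition H.verts (3 * t) l),
      Decomposition.IsRegularDecomposition H Q (ε₁ ^ D) (ε₂ l ^ D) →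
      (∀ i, Q.part i ⊆ Γ.A ∨ Q.part i ⊆ Γ.B ∨ Q.part i ⊆ G.right.biUnion C) →
    ∃ i j : Fin (3 * t), Q.part i ⊆ Γ.A ∧ Q.part j ⊆ Γ.B ∧
    ∃ (Z : Finset (Fin l)) (𝒞 : Fin l → Finset ν) (f : Fin l → ν → Bool),
      (ε₁ ^ D * (Γ.A.card : ℝ) / (3 * t) ≤ ((Q.part i).card : ℝ) ∧
        ε₁ ^ D * (Γ.B.card : ℝ) / (3 * t) ≤ ((Q.part j).card : ℝ)) ∧
      (1 - ε₁ ^ (D / 4)) * ((Q.part i).card : ℝ) * ((Q.part j).card : ℝ)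
        ≤ ((Z.biUnion (Q.P i j)).card : ℝ) ∧
      (∀ a ∈ Z, 𝒞 a ⊆ G.right ∧
        (1 - 3 * ε₁ ^ (D / 8)) * (G.right.card : ℝ) ≤ ((𝒞 a).card : ℝ)) ∧
      (∀ a ∈ Z,
        (1 - ε₁ ^ ((1 : ℝ) / 32)) * ((Q.P i j a).card : ℝ) ≤
          (((Q.P i j a).filter fun p =>
            ∀ v ∈ 𝒞 a, ∃ u ∈ G.nbr (f a v) v, ({p.1, p.2} : Finset α) ∈ Γ.P u).card : ℝ)) := by
  -- With `D = 64` the octahedron parameter `e ^ 64` is `r ^ 8` for `r = e ^ 8`, and `ε₁ ^ (D / 4)`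
  -- is `e ^ 16`.
  refine ⟨64, 1 / 2, by norm_num, by norm_num, ?_⟩
  intro υ ν _ _ G _ hGr _ e he hemin
  obtain ⟨heN, he2⟩ := lt_min_iff.1 hemin
  have hN : 0 < G.right.card := hGr.card_pos
  have hN' : (1 : ℝ) ≤ G.right.card := by exact_mod_cast hN
  have he100 : e < 1 / 1000 := he2.trans (by rw [Real.rpow_ofNat]; norm_num)
  have he1 : e < 1 := by linarith
  have hNe : (G.right.card : ℝ) ^ 2 * e ≤ 1 := by
    rw [Real.rpow_neg (by positivity), Real.rpow_ofNat, lt_inv_comm₀ he (by positivity)] at heN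
    calc _ ≤ (G.right.card : ℝ) ^ 64 * e := by
          gcongr
          norm_num
      _ ≤ e⁻¹ * e := by gcongr
      _ = 1 := inv_mul_cancel₀ he.ne'
  have hp {k m : ℕ} (h : m ≤ k) : e ^ k ≤ e ^ m := pow_le_pow_of_le_one he.le he1.le h
  -- This is `r ρ³` with `r = e ^ 8` and `ρ` the density threshold; its fourth power is the bound
  -- imposed on `ε₂`.
  set s : ℕ → ℝ := fun x => e ^ 8 * densityThreshold e G.right.card x ^ 3 with hs
  have hs0 (x : ℕ) : 0 < s x := by
    have := densityThreshold_pos he hN x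
    positivity
  have hs1 (x : ℕ) : s x < 1 :=
    mul_lt_one_of_nonneg_of_lt_one_left (by positivity) (pow_lt_one₀ he.le he1 (by norm_num))
      (pow_le_one₀ (densityThreshold_pos he hN x).le (densityThreshold_lt_one he he1 hN x).le)
  refine ⟨fun x => s x ^ 4, fun x => ⟨pow_pos (hs0 x) 4,
    pow_lt_one₀ (hs0 x).le (hs1 x) (by norm_num)⟩, ?_⟩
  intro t ht ε₂ hε₂ hε₂s
  -- The 1 for `ε` is a default value; `n₀ = 1` makes `n` positive.
  refine ⟨1, one_pos, 1, ?_⟩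
  intro n hn hNn α _ Γ hAn hBn _ C H hH l Q hQ hparts
  have hm : 0 < n / G.right.card := Nat.div_pos (Nat.le_of_dvd hn hNn) hN
  have hNm : G.right.card * (n / G.right.card) = n := Nat.mul_div_cancel' hNn
  have hAsub : Γ.A ⊆ H.verts := by
    rw [hH.verts_eq]; exact Finset.subset_union_left.trans Finset.subset_union_left
  have hBsub : Γ.B ⊆ H.verts := by
    rw [hH.verts_eq]; exact Finset.subset_union_right.trans Finset.subset_union_left
  have hCAB : Disjoint (G.right.biUnion C) (Γ.A ∪ Γ.B) :=
    (Finset.disjoint_biUnion_left _ _ _).2 hH.C_new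
  have hAB := Γ.A_disjoint_B
  rw [Finset.disjoint_union_right] at hCAB
  rw [Finset.disjoint_left] at hAB
  simp only [Finset.disjoint_left] at hCAB
  have hQA : ∀ i x, x ∈ Q.part i → x ∈ Γ.A → Q.part i ⊆ Γ.A := fun i x hx hxA => by
    rcases hparts i with h | h | h
    · exact h
    · exact absurd (h hx) (hAB hxA)
    · exact absurd hxA (hCAB.1 (h hx))
  have hQB : ∀ i x, x ∈ Q.part i → x ∈ Γ.B → Q.part i ⊆ Γ.B := fun i x hx hxB => by
    rcases hparts i with h | h | h
    · exact absurd hxB (hAB (h hx))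
    · exact h
    · exact absurd hxB (hCAB.2 (h hx))
  have hQC : ∀ i x, x ∈ Q.part i → x ∈ G.right.biUnion C → Q.part i ⊆ G.right.biUnion C :=
    fun i x hx hxC => by
    rcases hparts i with h | h | h
    · exact absurd (h hx) (hCAB.1 hxC)
    · exact absurd (h hx) (hCAB.2 hxC)
    · exact h
  have hverts : (H.verts.card : ℝ) ≤ 3 * n := by
    have h1 : H.verts.card ≤ n + n + G.right.card * (n / G.right.card) := by
      rw [hH.verts_eq]
      refine (Finset.card_union_le _ _).trans (add_le_add ?_ ?_)
      · rw [← hAn]; nth_rewrite 2 [hAn]; rw [← hBn]; exact Finset.card_union_le _ _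
      · refine Finset.card_biUnion_le.trans ?_
        rw [Finset.sum_congr rfl hH.card_C, Finset.sum_const, smul_eq_mul]
    rw [hNm] at h1
    have h2 : (H.verts.card : ℝ) ≤ n + n + n := by exact_mod_cast h1
    linarith
  have hreg : ((irregularTriples H Q (e ^ 64) (ε₂ l ^ 64)).card : ℝ) ≤ 27 * e ^ 64 * n ^ 3 := by
    have h1 := hQ.2
    rw [Real.rpow_ofNat, Real.rpow_ofNat] at h1
    calc _ ≤ e ^ 64 * (H.verts.card : ℝ) ^ 3 := h1
      _ ≤ e ^ 64 * (3 * n) ^ 3 := by gcongr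
      _ = _ := by ring
  have hη : ε₂ l ^ 64 ≤ (e ^ 8 * densityThreshold e G.right.card l ^ 3) ^ 4 :=
    (pow_le_of_le_one (hε₂ l).1.le (hε₂ l).2.le (by norm_num)).trans (hε₂s l).le
  have hδ1 : e ^ 64 < 1 / 4 := by
    have := hp (show 1 ≤ 64 by norm_num)
    rw [pow_one] at this
    linarith
  obtain ⟨i, j, hiA, hjB, hiL, hjL, hij⟩ := Q.exists_big_parts hAsub hBsub hQA hQB hn hAn hBn
    (pow_pos he 64) hδ1 hreg
  have ht' : (0 : ℝ) < t := by exact_mod_cast ht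
  have hn' : (0 : ℝ) < n := by exact_mod_cast hn
  have hi : 0 < (Q.part i).card := by
    have : (0 : ℝ) < (Q.part i).card := lt_of_lt_of_le (by rw [hAn]; push_cast; positivity) hiL
    exact_mod_cast this
  have hj : 0 < (Q.part j).card := by
    have : (0 : ℝ) < (Q.part j).card := lt_of_lt_of_le (by rw [hBn]; push_cast; positivity) hjL
    exact_mod_cast this
  -- `2θ = e ^ 16` is the loss allowed in conclusion 2, and `κ` is then determined by `θ κ = 54 e ^
  -- 64`.
  have hZcover := Q.le_card_biUnion_good_classes i j hn (δ := e ^ 64) (θ := e ^ 16 / 2)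
    (κ := 108 * e ^ 48) (by positivity) (by positivity) (le_of_eq (by ring)) hij
  set Z := Finset.univ.filter fun a : Fin l =>
    e ^ 16 / 2 * ((Q.part i).card * (Q.part j).card) / l ≤ (Q.P i j a).card ∧
      (((irregularTriples H Q (e ^ 64) (ε₂ l ^ 64)).filter fun p =>
        (p.1, p.2.1) ∈ Q.P i j a).card : ℝ) ≤ 108 * e ^ 48 * (Q.P i j a).card * n with hZ
  have hκ : 108 * e ^ 48 * G.right.card ≤ 1 / 8 := by
    have h1 : (G.right.card : ℝ) * e ≤ 1 := by
      refine le_trans ?_ hNe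
      gcongr
      nlinarith
    calc 108 * e ^ 48 * (G.right.card : ℝ) = 108 * e ^ 47 * (G.right.card * e) := by ring
      _ ≤ 108 * e * 1 := by
          have := hp (show 1 ≤ 47 by norm_num)
          rw [pow_one] at this
          gcongr
      _ ≤ _ := by linarith
  classical
  -- The membership conditions sit inside the existential, so that `choose` yields a total function
  -- `f`.
  have hconst : ∀ a v, ∃ f : Bool, a ∈ Z → v ∈ G.right → (((Q.P i j a).filter fun p =>
      ¬ ((∃ u ∈ G.nbr true v, ({p.1, p.2} : Finset α) ∈ Γ.P u) ↔ f = true)).card : ℝ) ≤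
        18 * (4 * G.right.card) * e ^ 8 * (Q.P i j a).card := by
    intro a v
    by_cases hav : a ∈ Z ∧ v ∈ G.right
    · obtain ⟨ha, hv⟩ := hav
      obtain ⟨-, ha1, ha2⟩ := Finset.mem_filter.1 ha
      have h64 : e ^ 64 = (e ^ 8) ^ 8 := by rw [← pow_mul]
      obtain ⟨f, hf⟩ := hH.nearly_constant_on_class hm Q hQC hiA hjB hi hj (a := a) hv
        (pow_nonneg he.le 8) (pow_le_one₀ he.le he1.le) hη (by positivity)
        (densityThreshold_pos he hN l) (densityThreshold_mul_le he hN l) hκ ha1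
        (by rw [hNm, ← h64]; exact ha2)
      exact ⟨f, fun _ _ => hf⟩
    · exact ⟨true, fun h1 h2 => absurd ⟨h1, h2⟩ hav⟩
  choose f hf using hconst
  refine ⟨i, j, hiA, hjB, Z, fun _ => G.right, f, ⟨?_, ?_⟩, ?_, ?_, ?_⟩
  · rw [Real.rpow_ofNat]
    push_cast at hiL
    exact hiL
  · rw [Real.rpow_ofNat]
    push_cast at hjL
    exact hjL
  · rw [show (64 : ℝ) / 4 = 16 by norm_num, Real.rpow_ofNat]
    calc _ = (1 - 2 * (e ^ 16 / 2)) * ((Q.part i).card : ℝ) * (Q.part j).card := by ring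
      _ ≤ _ := hZcover
  · intro a _
    refine ⟨subset_rfl, mul_le_of_le_one_left (by positivity) ?_⟩
    have : 0 < e ^ ((64 : ℝ) / 8) := Real.rpow_pos_of_pos he _
    linarith
  · intro a ha
    -- The union bound costs `72 |V|² e ^ 8`. One factor `e` absorbs `|V|²`, another absorbs 72, and
    -- a remaining one is below `e ^ (1/32)`.
    have hsmall : (G.right.card : ℝ) * (18 * (4 * G.right.card) * e ^ 8) ≤ e ^ ((1 : ℝ) / 32) := by
      calc _ = 72 * (G.right.card ^ 2 * e) * e ^ 6 * e := by ring
        _ ≤ 72 * 1 * e * e := by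
            have := hp (show 1 ≤ 6 by norm_num)
            rw [pow_one] at this
            gcongr
        _ ≤ 1 * e := by
            gcongr
            linarith
        _ = e ^ (1 : ℝ) := by rw [one_mul, Real.rpow_one]
        _ ≤ _ := Real.rpow_le_rpow_of_exponent_ge he he1.le (by norm_num)
    have hu := sub_le_card_filter_forall (Q.P i j a) G.right
      (fun v p => (∃ u ∈ G.nbr true v, ({p.1, p.2} : Finset α) ∈ Γ.P u) ↔ f a v = true)
      (fun v hv => hf a v ha hv)
    calc _ = ((Q.P i j a).card : ℝ) - e ^ ((1 : ℝ) / 32) * (Q.P i j a).card := by ring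
      _ ≤ (Q.P i j a).card -
          G.right.card * (18 * (4 * G.right.card) * e ^ 8) * (Q.P i j a).card := by gcongr
      _ = (Q.P i j a).card -
          G.right.card * (18 * (4 * G.right.card) * e ^ 8 * (Q.P i j a).card) := by ring
      _ ≤ _ := hu
      _ ≤ _ := by
          refine Nat.cast_le.2 (Finset.card_le_card fun p hp => ?_)
          obtain ⟨hpP, hpv⟩ := Finset.mem_filter.1 hp
          obtain ⟨hp1, hp2⟩ := Finset.mem_product.1 (Q.P_sub i j a hpP)
          exact Finset.mem_filter.2 ⟨hpP, fun v hv =>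
            exists_nbr_of_iff Γ (hiA hp1) (hjB hp2) (hpv v hv)⟩
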